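/- **Network.** Consider $M$ queues in slotted time; $X_t\in\mathbb N^M$ is the row vector of queue lengths at time $t$. Let $R\in\{0,1\}^{M\times M}$ be the routing matrix ($r^{(m,p)}=1$ iff customers leaving queue $m$ enter queue $p$): each row contains at most one $1$, and $R$ is nilpotent (every customer leaves the network after finitely many hops). The queues evolve by $$X_{t+1}=X_t+A_t-D_t(I-R),$$ where $A_t\in\mathbb N^M$ are the external arrivals and $D_t\in\mathbb N^M$ the departures of slot $t$; $X_0$ is bounded. *Service constraints.* $S^D_t$ is an irreducible Markov chain on a finite set $\mathcal S^D$ with stationary distribution $\pi$. For each $s\in\mathcal S^D$ there are a compact convex region $\mathcal D(s)\subset\mathbb R^M$ and a set of feasible departure vectors in $\mathbb N^M\cap\mathcal D(s)$, which contains every vertex of $\mathcal D(s)$ and contains the componentwise minimum $\min(D,x)$ for every feasible $D$ and every $x\in\mathbb N^M$. The constraints are *static* if they do not depend on $s$, and *dynamic* in general. *Arrivals.* $S^A_t$ is an irreducible Markov chain on a finite set; given that $S^A_t=s$, the vector $A_t$ has a law $\nu_s$ on $\mathbb N^M$ with bounded support (Markov modulated, "MMBP", arrivals). Precisely, given all the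 information available at time $t$ (in particular $X_t,D_t,S^A_t,S^D_t$), the variables $A_t$, $S^A_{t+1}$, $S^D_{t+1}$ are independent, with laws depending only on $S^A_t$, $S^A_t$ and $S^D_t$, respectively. The arrivals are *i.i.d.* if $\nu_s$ does not depend on $s$. Let $\Lambda$ be the mean of $A_t$ when $S^A_t$ is at steady state. The arrivals are *admissible* if $\Lambda$ lies in the interior of the set of those $\Lambda'\in\mathbb R^M$ for which $\Lambda'(I-R)^{-1}=\sum_{s}\pi_sD(s)$ for some vectors $D(s)\in\mathcal D(s)$. *Policy.* For a $C^1$ function $G:\mathbb R_{\ge0}^M\to\mathbb R$ the *$\nabla G$-max-scalar policy* chooses at each time a feasible $D_t\in\mathcal D(S^D_t)$ with $D_t\le X_t$ that maximizes $\langle\nabla G(X_t)(I-R)^T\cdot D\rangle$ among all feasible $D\le X_t$ (ties being broken arbitrarily, using only the information available at time $t$). **Potentials.** Below, "$\|X\|\to\infty$" means that the Euclidean norm of $X\in\mathbb R_{\ge0}^M$ tends to infinity, uniformly in the direction of $X$. Consider the following conditions. 1. $G(X)/\|X\|\to\infty$ as $\|X\|\to\infty$, and $\|\nabla G(X)\|$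 is bounded away from $0$ for $\|X\|$ large. 2. $\langle\nabla G(X)(I-R)^T\cdot D\rangle\le0$ for all $X,D\in\mathbb R_{\ge0}^M$ with $\langle X\cdot D\rangle=0$. 3. For some $D\in\mathbb R_{\ge0}^M$, $\displaystyle\liminf_{\|X\|\to\infty}\frac{\langle\nabla G(X)(I-R)^T\cdot D\rangle}{\|\nabla G(X)\|}>0$. $G$ is a *weak potential* if it is $C^2$ on $\mathbb R_{\ge0}^M$, satisfies 1–3, and for every $B>0$, as $\|X\|\to\infty$, $$\frac{G(X+Y)}{G(X)}\to1\quad\text{and}\quad\frac{\|\nabla G(X+Y)-\nabla G(X)\|}{\|\nabla G(X)\|}\to0$$ uniformly over all $Y$ with $\|Y\|\le B$ and $X+Y\in\mathbb R^M_{\ge0}$. $G$ is a *strong potential* if it is $C^\infty$ on $\mathbb R_{\ge0}^M$, satisfies 1–3, and there is $h_0\in\mathbb N$ such that $\limsup_{\|X\|\to\infty}\|\partial^{h_0}G(X)\|<\infty$ and $\|\partial^{h+1}G(X)\|=o(\|\partial^{h}G(X)\|)$ as $\|X\|\to\infty$ for every $h<h_0$, where $\partial^hG(X)$ is the $h$-th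 derivative (a multilinear form). **Statement.** Let the network be run by the $\nabla G$-max-scalar policy under admissible arrivals. (a) If $G$ is a weak potential, the arrivals are i.i.d. and the service constraints are static, then the network is $\|X\|^h$-stable for every $h\in\mathbb N$, that is, $\limsup_{t\to\infty}\mathbb E\big[\|X_t\|^h\big]<\infty$. (b) If $G$ is a strong potential, the network is $\|X\|^h$-stable for every $h\in\mathbb N$ under MMBP arrivals and dynamic service constraints. -/

import Mathlib

open MeasureTheory ProbabilityTheory Filter Topology
open scoped ENNReal InnerProductSpace

noncomputable section

namespace QueueNet

/-! ### Vectors -/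

/-- Row vectors in `ℝ^M` with the Euclidean norm. -/
abbrev Vec (M : ℕ) : Type := EuclideanSpace ℝ (Fin M)

/-- The closed nonnegative orthant of `ℝ^M`. -/
def orthant (M : ℕ) : Set (Vec M) := {x | ∀ m, 0 ≤ x m}

/-- A vector of numbers of customers, seen in `ℝ^M`. -/
def toVec {M : ℕ} (x : Fin M → ℕ) : Vec M := WithLp.toLp 2 fun m => (x m : ℝ)

/-- `‖X‖ → ∞` with `X` in the nonnegative orthant (uniformly in the direction of `X`). -/
def atInfinity (M : ℕ) : Filter (Vec M) := Bornology.cobounded (Vec M) ⊓ 𝓟 (orthant M)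

/-! ### The network -/

/-- A routing matrix: `R m p = 1` when customers leaving the queue `m` enter the queue `p`. There is
no forking, and every customer leaves the network after finitely many hops. -/
structure IsRouting {M : ℕ} (R : Matrix (Fin M) (Fin M) ℝ) : Prop where
  zero_or_one : ∀ m p, R m p = 0 ∨ R m p = 1
  no_forking : ∀ m p q, R m p = 1 → R m q = 1 → p = q
  leaves : IsNilpotent R

/-- Service constraints depending on an environment state `s : S`: the region `region s` of `ℝ^M`
to which the departure vectors are constrained, and the set `feasible s` of those departure
vectors (numbers of customers) that satisfy all the constraints. -/
structure ServiceConstraints (M : ℕ) (S : Type*) where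
  region : S → Set (Vec M)
  feasible : S → Set (Fin M → ℕ)
  isCompact_region : ∀ s, IsCompact (region s)
  convex_region : ∀ s, Convex ℝ (region s)
  feasible_subset : ∀ s, ∀ D ∈ feasible s, toVec D ∈ region s
  /-- Every vertex of the region is a feasible departure vector. -/
  vertex_feasible : ∀ s, Set.extremePoints ℝ (region s) ⊆ toVec '' feasible s
  /-- Truncating a feasible departure vector at the queue lengths leaves it feasible. -/
  min_feasible : ∀ s, ∀ D ∈ feasible s, ∀ x : Fin M → ℕ, D ⊓ x ∈ feasible s

/-- The constraints do not depend on the environment. -/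
def ServiceConstraints.IsStatic {M : ℕ} {S : Type*} (C : ServiceConstraints M S) : Prop :=
  ∀ s s', C.region s = C.region s' ∧ C.feasible s = C.feasible s'

/-- An irreducible Markov chain on a finite state space, with its stationary distribution. -/
structure FiniteChain (S : Type*) [Fintype S] where
  P : Matrix S S ℝ
  row_sum : ∀ s, ∑ s', P s s' = 1
  irreducible : P.IsIrreducible
  stat : S → ℝ
  stat_nonneg : ∀ s, 0 ≤ stat s
  stat_sum : ∑ s, stat s = 1
  stationary : ∀ s', ∑ s, stat s * P s s' = stat s'

/-- Markov modulated arrivals: in modulating state `s` the vector of external arrivals of a slot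
has law `law s`; the numbers of arrivals are bounded by a constant. -/
structure Arrivals (M : ℕ) (S : Type*) where
  law : S → PMF (Fin M → ℕ)
  bounded : ∃ B : ℕ, ∀ s, ∀ a ∈ (law s).support, ∀ m, a m ≤ B

/-- The law of the arrivals does not depend on the modulating state: i.i.d. arrivals. -/
def Arrivals.IsIID {M : ℕ} {S : Type*} (a : Arrivals M S) : Prop :=
  ∀ s s', a.law s = a.law s'

/-- The vector `Λ` of average arrival rates, the modulating chain being at steady state. -/
def Arrivals.rate {M : ℕ} {S : Type*} [Fintype S] (a : Arrivals M S) (c : FiniteChain S) : Vec M :=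
  WithLp.toLp 2 fun m => ∑ s, c.stat s * ∑' x : Fin M → ℕ, (a.law s x).toReal * (x m : ℝ)

/-- The rate-stability capacity region: the rate vectors `Λ` whose workload `Λ (I - R)⁻¹` is of
the form `∑ s, π s • D s` with `D s` in `region s`. -/
def capacityRegion {M : ℕ} {S : Type*} [Fintype S] (R : Matrix (Fin M) (Fin M) ℝ)
    (C : ServiceConstraints M S) (c : FiniteChain S) : Set (Vec M) :=
  {Λ | ∃ D : S → Vec M, (∀ s, D s ∈ C.region s) ∧
    WithLp.toLp 2 (Matrix.vecMul (WithLp.ofLp Λ) (1 - R)⁻¹) = ∑ s, c.stat s • D s}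

/-- Admissible rates: the interior of the capacity region. -/
def IsAdmissible {M : ℕ} {S : Type*} [Fintype S] (R : Matrix (Fin M) (Fin M) ℝ)
    (C : ServiceConstraints M S) (c : FiniteChain S) (Λ : Vec M) : Prop :=
  Λ ∈ interior (capacityRegion R C c)

/-! ### Potentials -/

/-- The gradient of `G` on the nonnegative orthant (one-sided at the boundary). -/
def grad {M : ℕ} (G : Vec M → ℝ) (X : Vec M) : Vec M := gradientWithin G (orthant M) X

/-- The vector of pressures `∇G(X) (I - R)ᵀ`. -/
def pressure {M : ℕ} (R : Matrix (Fin M) (Fin M) ℝ) (G : Vec M → ℝ) (X : Vec M) : Vec M :=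
  WithLp.toLp 2 (Matrix.vecMul (WithLp.ofLp (grad G X)) (1 - R).transpose)

/-- The conditions that weak and strong potentials have in common. -/
structure IsPrePotential {M : ℕ} (R : Matrix (Fin M) (Fin M) ℝ) (G : Vec M → ℝ) : Prop where
  superlinear : Tendsto (fun X => G X / ‖X‖) (atInfinity M) atTop
  /-- `∇G` does not degenerate at infinity. -/
  grad_nondegenerate : ∃ c > 0, ∀ᶠ X in atInfinity M, c ≤ ‖grad G X‖
  pressure_nonpos : ∀ X ∈ orthant M, ∀ D ∈ orthant M,
    ⟪X, D⟫_ℝ = 0 → ⟪pressure R G X, D⟫_ℝ ≤ 0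
  pressure_pos : ∃ D ∈ orthant M, ∃ c > 0, ∀ᶠ X in atInfinity M,
    c ≤ ⟪pressure R G X, D⟫_ℝ / ‖grad G X‖

/-- Weak potentials: `C²`, with `G` and `∇G` of sub-exponential growth, that is
`G (X + Y) / G X → 1` and `‖∇G (X + Y) - ∇G X‖ / ‖∇G X‖ → 0` as `‖X‖ → ∞`, for bounded `Y`. -/
structure IsWeakPotential {M : ℕ} (R : Matrix (Fin M) (Fin M) ℝ) (G : Vec M → ℝ) : Prop
    extends IsPrePotential R G where
  contDiffOn : ContDiffOn ℝ 2 G (orthant M)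
  subexp : ∀ B > 0, ∀ ε > 0, ∀ᶠ X in atInfinity M, ∀ Y : Vec M, ‖Y‖ ≤ B → X + Y ∈ orthant M →
    |G (X + Y) / G X - 1| ≤ ε
  subexp_grad : ∀ B > 0, ∀ ε > 0, ∀ᶠ X in atInfinity M, ∀ Y : Vec M, ‖Y‖ ≤ B →
    X + Y ∈ orthant M → ‖grad G (X + Y) - grad G X‖ ≤ ε * ‖grad G X‖

/-- Strong potentials: smooth, with a bounded derivative of some order `h₀` at infinity, and with
each derivative of order at most `h₀` negligible at infinity with respect to the previous one. -/
structure IsStrongPotential {M : ℕ} (R : Matrix (Fin M) (Fin M) ℝ) (G : Vec M → ℝ) : Prop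
    extends IsPrePotential R G where
  contDiffOn : ContDiffOn ℝ ((⊤ : ℕ∞) : WithTop ℕ∞) G (orthant M)
  polynomial : ∃ h₀ : ℕ,
    (∃ K, ∀ᶠ X in atInfinity M, ‖iteratedFDerivWithin ℝ h₀ G (orthant M) X‖ ≤ K) ∧
    ∀ h < h₀, (fun X => iteratedFDerivWithin ℝ (h + 1) G (orthant M) X) =o[atInfinity M]
      fun X => iteratedFDerivWithin ℝ h G (orthant M) X

/-! ### The policy, the evolution of the queues, and stability -/

/-- `D` is a choice of the `∇G`-max-scalar policy in environment state `s` at queue lengths `x`: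
among the feasible departure vectors `D ≤ x` it maximizes `⟨∇G(x) (I - R)ᵀ, D⟩`. -/
def IsMaxScalar {M : ℕ} {S : Type*} (R : Matrix (Fin M) (Fin M) ℝ) (C : ServiceConstraints M S)
    (G : Vec M → ℝ) (s : S) (x D : Fin M → ℕ) : Prop :=
  IsMaxOn (fun E : Fin M → ℕ => ⟪pressure R G (toVec x), toVec E⟫_ℝ)
    {E | E ∈ C.feasible s ∧ E ≤ x} D ∧ D ∈ C.feasible s ∧ D ≤ x

/-- A network run by the `∇G`-max-scalar policy: `X t` are the queue lengths at time `t`, `A t` the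
external arrivals and `D t` the departures in the slot `(t, t + 1]`, `SA t` and `SD t` the states
of the chains that modulate the arrivals and the service constraints. The information available
when `D t` is chosen is `ℱ t`; ties may be broken in any way that uses only this information. -/
structure IsMaxScalarNetwork {M : ℕ} {SA SD : Type*} [Fintype SA] [Fintype SD]
    [MeasurableSpace SA] [MeasurableSpace SD]
    (R : Matrix (Fin M) (Fin M) ℝ) (C : ServiceConstraints M SD) (cA : FiniteChain SA)
    (cD : FiniteChain SD) (a : Arrivals M SA) (G : Vec M → ℝ)
    {Ω : Type*} [mΩ : MeasurableSpace Ω] (μ : Measure Ω) (ℱ : Filtration ℕ mΩ)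
    (X A D : ℕ → Ω → Fin M → ℕ) (sA : ℕ → Ω → SA) (sD : ℕ → Ω → SD) : Prop where
  measurable_X : ∀ t, Measurable[ℱ t] (X t)
  measurable_D : ∀ t, Measurable[ℱ t] (D t)
  measurable_sA : ∀ t, Measurable[ℱ t] (sA t)
  measurable_sD : ∀ t, Measurable[ℱ t] (sD t)
  measurable_A : ∀ t, Measurable[ℱ (t + 1)] (A t)
  /-- The initial queue lengths are bounded. -/
  initial : ∃ B : ℕ, ∀ᵐ ω ∂μ, ∀ m, X 0 ω m ≤ B
  /-- Given the information at time `t`, the arrivals of the slot and the next states of the two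
  chains are independent, with laws depending only on the current states of the chains. -/
  transition : ∀ (t : ℕ) (x : Fin M → ℕ) (i : SA) (j : SD),
    μ[{ω | A t ω = x ∧ sA (t + 1) ω = i ∧ sD (t + 1) ω = j}.indicator (fun _ => (1 : ℝ)) | ℱ t]
      =ᵐ[μ] fun ω => (a.law (sA t ω) x).toReal * cA.P (sA t ω) i * cD.P (sD t ω) j
  /-- `X (t + 1) = X t + A t - D t (I - R)`. -/
  evolution : ∀ t ω, toVec (X (t + 1) ω) = toVec (X t ω) + toVec (A t ω)
    - WithLp.toLp 2 (Matrix.vecMul (WithLp.ofLp (toVec (D t ω))) (1 - R))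
  policy : ∀ t ω, IsMaxScalar R C G (sD t ω) (X t ω) (D t ω)

/-- `F`-stability: `limsup E[F(X_t)] < ∞` as `t → ∞`. -/
def IsStable {M : ℕ} {Ω : Type*} [MeasurableSpace Ω] (μ : Measure Ω)
    (X : ℕ → Ω → Fin M → ℕ) (F : Vec M → ℝ) : Prop :=
  limsup (fun t => ∫⁻ ω, ENNReal.ofReal (F (toVec (X t ω))) ∂μ) atTop < ∞

end QueueNet

end

noncomputable section

namespace QueueNet

/-! ### Moment bounds from a drift condition -/

/-- Iterated negative drift forces quadratic decay. -/
theorem quadratic_decay {b₀ b₁ b₂ : ℕ → ℝ} {δ C : ℝ} (hδ : 0 < δ) (hb₁ : ∀ k, 0 ≤ b₁ k)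
    (hb₂ : ∀ k, 0 ≤ b₂ k) (h₀ : ∀ k, b₀ (k + 1) ≤ b₀ k)
    (h₁ : ∀ k, b₁ (k + 1) ≤ b₁ k - δ * b₀ k) (h₂ : ∀ k, b₂ (k + 1) ≤ b₂ k - δ * b₁ k)
    (hC : b₂ 0 ≤ C) (k : ℕ) : δ ^ 2 * (k * (k + 1) / 2) * b₀ k ≤ C := by
  have key : ∀ k : ℕ, b₂ k + δ * k * b₁ k + δ ^ 2 * (k * (k + 1) / 2) * b₀ k ≤ C := by
    intro k
    induction k with
    | zero => simpa using hC
    | succ k ih =>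
      refine le_trans ?_ ih
      have e₁ := mul_le_mul_of_nonneg_left (h₁ k) (by positivity : 0 ≤ δ * ((k : ℝ) + 1))
      have e₀ := mul_le_mul_of_nonneg_left (h₀ k)
        (by positivity : 0 ≤ δ ^ 2 * (((k : ℝ) + 1) * (k + 1 + 1) / 2))
      push_cast
      linarith [h₂ k]
  have := key k
  have h3 : 0 ≤ δ * k * b₁ k := mul_nonneg (by positivity) (hb₁ k)
  linarith [hb₂ k]

theorem sum_inv_mul_succ_le (n : ℕ) :
    ∑ k ∈ Finset.range n, (1 : ℝ) / ((k + 1) * (k + 2)) ≤ 1 := by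
  have : ∑ k ∈ Finset.range n, (1 : ℝ) / ((k + 1) * (k + 2)) = 1 - 1 / (n + 1) := by
    induction n with
    | zero => simp
    | succ n ih =>
      rw [Finset.sum_range_succ, ih]
      push_cast
      field_simp
      ring
  rw [this]
  have : (0 : ℝ) ≤ 1 / (n + 1) := by positivity
  linarith

/-- The event that `s` is the last time up to `t` at which `κ` occurs. -/
def lastVisit {Ω : Type*} (κ : ℕ → Set Ω) (s t : ℕ) : Set Ω :=
  κ s ∩ ⋂ i ∈ Finset.Ioc s t, (κ i)ᶜ

theorem lastVisit_self {Ω : Type*} (κ : ℕ → Set Ω) (s : ℕ) : lastVisit κ s s = κ s := by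
  simp [lastVisit]

theorem lastVisit_succ {Ω : Type*} (κ : ℕ → Set Ω) {s t : ℕ} (h : s ≤ t) :
    lastVisit κ s (t + 1) = lastVisit κ s t ∩ (κ (t + 1))ᶜ := by
  ext ω
  simp only [lastVisit, Set.mem_inter_iff, Set.mem_iInter, Finset.mem_Ioc, and_assoc]
  refine and_congr_right fun _ => ⟨fun H => ⟨fun i hi => H i ⟨hi.1, by omega⟩,
    H _ ⟨by omega, le_rfl⟩⟩, fun H i hi => ?_⟩
  rcases Nat.lt_or_ge t i with h' | h'
  · obtain rfl : i = t + 1 := by omega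
    exact H.2
  · exact H.1 i ⟨hi.1, h'⟩

theorem lastVisit_subset {Ω : Type*} (κ : ℕ → Set Ω) (s t : ℕ) : lastVisit κ s t ⊆ κ s :=
  Set.inter_subset_left

theorem measurableSet_lastVisit {Ω : Type*} {mΩ : MeasurableSpace Ω} {ℱ : Filtration ℕ mΩ}
    {κ : ℕ → Set Ω} (hκ : ∀ t, MeasurableSet[ℱ t] (κ t)) {s t : ℕ} (h : s ≤ t) :
    MeasurableSet[ℱ t] (lastVisit κ s t) := by
  induction t, h using Nat.le_induction with
  | base => rw [lastVisit_self]; exact hκ s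
  | succ t h ih =>
    rw [lastVisit_succ κ h]
    exact (ℱ.mono (Nat.le_succ t) _ ih).inter (hκ _).compl

theorem integral_eq_sum_lastVisit {Ω : Type*} {mΩ : MeasurableSpace Ω} {μ : Measure Ω}
    {ℱ : Filtration ℕ mΩ} {κ : ℕ → Set Ω} (hκ : ∀ t, MeasurableSet[ℱ t] (κ t))
    (hκ₀ : κ 0 = Set.univ) (t : ℕ) : ∀ f : Ω → ℝ, Integrable f μ →
    ∫ ω, f ω ∂μ = ∑ s ∈ Finset.range (t + 1), ∫ ω in lastVisit κ s t, f ω ∂μ := by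
  induction t with
  | zero => intro f _; simp [lastVisit_self, hκ₀]
  | succ t ih =>
    intro f hf
    have hm : MeasurableSet (κ (t + 1)) := ℱ.le _ _ (hκ _)
    rw [Finset.sum_range_succ, lastVisit_self, ← integral_add_compl hm hf, add_comm,
      ← integral_indicator hm.compl, ih _ (hf.indicator hm.compl)]
    congr 1
    refine Finset.sum_congr rfl fun s hs => ?_
    rw [lastVisit_succ κ (by simpa [Nat.lt_succ_iff] using hs), setIntegral_indicator hm.compl]

/-- **Moment bounds from negative drift.** If the powers of a nonnegative adapted process have a
negative drift outside the events `κ t`, and the process is bounded on `κ t` and one step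
afterwards, then its moments are bounded uniformly in time. -/
theorem exists_moment_bound {Ω : Type*} {mΩ : MeasurableSpace Ω} (μ : Measure Ω)
    [IsProbabilityMeasure μ] (ℱ : Filtration ℕ mΩ) (V : ℕ → Ω → ℝ) (κ : ℕ → Set Ω)
    (hκ₀ : κ 0 = Set.univ) (hκ : ∀ t, MeasurableSet[ℱ t] (κ t)) (hV : ∀ t, Measurable (V t))
    (hpos : ∀ t ω, 0 ≤ V t ω) (hbdd : ∀ t, ∃ c, ∀ᵐ ω ∂μ, V t ω ≤ c) {B δ : ℝ} (hδ : 0 < δ)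
    (hB : ∀ t, ∀ᵐ ω ∂μ, ω ∈ κ t → V t ω ≤ B ∧ V (t + 1) ω ≤ B) (n : ℕ)
    (hdrift : ∀ t, ∀ S, MeasurableSet[ℱ t] S → S ⊆ (κ t)ᶜ → ∀ k ≤ n + 2,
      ∫ ω in S, V (t + 1) ω ^ (k + 1) ∂μ
        ≤ ∫ ω in S, V t ω ^ (k + 1) ∂μ - δ * ∫ ω in S, V t ω ^ k ∂μ) :
    ∃ C, ∀ t, ∫ ω, V t ω ^ (n + 1) ∂μ ≤ C := by
  have hint : ∀ t k, Integrable (fun ω => V t ω ^ k) μ := by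
    intro t k
    obtain ⟨c, hc⟩ := hbdd t
    refine Integrable.of_bound ((hV t).pow_const k).aestronglyMeasurable (c ^ k) ?_
    filter_upwards [hc] with ω h
    rw [Real.norm_of_nonneg (pow_nonneg (hpos t ω) k)]
    exact pow_le_pow_left₀ (hpos t ω) h k
  have hnn : ∀ S t k, 0 ≤ ∫ ω in S, V t ω ^ k ∂μ := fun S t k =>
    integral_nonneg fun ω => pow_nonneg (hpos t ω) k
  set B₁ := max B 0
  have hB₁ : 0 ≤ B₁ := le_max_right _ _
  -- integrals over parts of `κ s`
  have hsmall : ∀ s t S k, MeasurableSet S → S ⊆ κ s → (t = s ∨ t = s + 1) →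
      ∫ ω in S, V t ω ^ k ∂μ ≤ B₁ ^ k := by
    intro s t S k hS hSκ ht
    calc ∫ ω in S, V t ω ^ k ∂μ ≤ ∫ ω in S, B₁ ^ k ∂μ := by
          refine setIntegral_mono_on_ae (hint t k).integrableOn (integrable_const _).integrableOn
            hS ?_
          filter_upwards [hB s] with ω h hω
          refine pow_le_pow_left₀ (hpos t ω) (le_trans ?_ (le_max_left _ _)) k
          rcases ht with rfl | rfl
          · exact (h (hSκ hω)).1
          · exact (h (hSκ hω)).2
      _ = μ.real S * B₁ ^ k := by simp
      _ ≤ 1 * B₁ ^ k := by gcongr; exact measureReal_le_one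
      _ = B₁ ^ k := one_mul _
  set b : ℕ → ℕ → ℕ → ℝ := fun s k j =>
    ∫ ω in lastVisit κ s (s + 1 + j), V (s + 1 + j) ω ^ k ∂μ with hb
  have hstep : ∀ s k j, k ≤ n + 2 → b s (k + 1) (j + 1) ≤ b s (k + 1) j - δ * b s k j := by
    intro s k j hk
    refine le_trans ?_ (hdrift (s + 1 + j) (lastVisit κ s (s + 1 + j))
      (measurableSet_lastVisit hκ (by omega)) ?_ k hk)
    · simp only [hb]
      refine setIntegral_mono_set (hint _ _).integrableOn
        (ae_of_all _ fun ω => pow_nonneg (hpos _ ω) _) ?_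
      rw [← add_assoc, lastVisit_succ κ (by omega : s ≤ s + 1 + j)]
      exact Set.inter_subset_left.eventuallyLE
    · have : s + 1 + j = s + j + 1 := by omega
      rw [this, lastVisit_succ κ (by omega : s ≤ s + j)]
      exact Set.inter_subset_right
  have hbound : ∀ s j, b s (n + 1) j ≤ (B₁ ^ (n + 1) + B₁ ^ (n + 3)) * (1 + 1 / δ ^ 2) * 6 *
      (1 / ((j + 1) * (j + 2))) := by
    intro s j
    have hm : MeasurableSet (lastVisit κ s (s + 1)) :=
      ℱ.le _ _ (measurableSet_lastVisit hκ (Nat.le_succ s))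
    have hanti : ∀ j, b s (n + 1) (j + 1) ≤ b s (n + 1) j := fun j =>
      (hstep s n j (by omega)).trans (sub_le_self _ (mul_nonneg hδ.le (hnn _ _ _)))
    have hq := quadratic_decay (b₀ := b s (n + 1)) (b₁ := b s (n + 2)) (b₂ := b s (n + 3))
      (C := B₁ ^ (n + 3)) hδ (fun k => hnn _ _ (n + 2))
      (fun k => hnn _ _ (n + 3)) hanti (fun j => hstep s (n + 1) j (by omega))
      (fun j => hstep s (n + 2) j (by omega))
      (hsmall s _ _ _ hm (lastVisit_subset κ s _) (Or.inr rfl)) j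
    have hp1 : 0 ≤ B₁ ^ (n + 1) := pow_nonneg hB₁ _
    have hp3 : 0 ≤ B₁ ^ (n + 3) := pow_nonneg hB₁ _
    have hδ2 : 0 < 1 / δ ^ 2 := by positivity
    rw [mul_one_div, le_div_iff₀ (by positivity)]
    rcases Nat.eq_zero_or_pos j with rfl | hj
    · have h0 : b s (n + 1) 0 ≤ B₁ ^ (n + 1) :=
        hsmall s _ _ _ hm (lastVisit_subset κ s _) (Or.inr rfl)
      norm_num
      nlinarith [mul_nonneg (add_nonneg hp1 hp3) hδ2.le, one_div (δ ^ 2)]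
    · have hj1 : (1 : ℝ) ≤ j := by exact_mod_cast hj
      have h1 : (j * (j + 1) / 2 : ℝ) * b s (n + 1) j ≤ B₁ ^ (n + 3) * (1 / δ ^ 2) := by
        rw [mul_one_div, le_div_iff₀ (by positivity)]
        calc _ = δ ^ 2 * (j * (j + 1) / 2) * b s (n + 1) j := by ring
          _ ≤ _ := hq
      have hbn : 0 ≤ b s (n + 1) j := hnn _ _ _
      have h2 : b s (n + 1) j * ((j + 1) * (j + 2)) ≤ 6 * ((j * (j + 1) / 2 : ℝ) * b s (n + 1) j) := by
        nlinarith [mul_nonneg hbn (by nlinarith : (0:ℝ) ≤ 3 * (j * (j + 1)) - (j + 1) * (j + 2))]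
      nlinarith [mul_nonneg hp1 hδ2.le]
  set K := (B₁ ^ (n + 1) + B₁ ^ (n + 3)) * (1 + 1 / δ ^ 2) * 6
  have hK : 0 ≤ K := by positivity
  refine ⟨K + B₁ ^ (n + 1), fun t => ?_⟩
  rw [integral_eq_sum_lastVisit hκ hκ₀ t _ (hint t (n + 1)), Finset.sum_range_succ,
    lastVisit_self]
  refine add_le_add ?_ (hsmall t t _ _ (ℱ.le _ _ (hκ t)) subset_rfl (Or.inl rfl))
  calc ∑ s ∈ Finset.range t, ∫ ω in lastVisit κ s t, V t ω ^ (n + 1) ∂μ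
      ≤ ∑ s ∈ Finset.range t, K * (1 / (((t - 1 - s : ℕ) + 1 : ℝ) * ((t - 1 - s : ℕ) + 2))) := by
        refine Finset.sum_le_sum fun s hs => ?_
        have := hbound s (t - 1 - s)
        have ht : s + 1 + (t - 1 - s) = t := by have := Finset.mem_range.1 hs; omega
        simpa only [hb, ht] using this
    _ = K * ∑ j ∈ Finset.range t, (1 : ℝ) / ((j + 1) * (j + 2)) := by
        rw [← Finset.mul_sum, Finset.sum_range_reflect
          fun j : ℕ => (1 : ℝ) / ((j + 1) * (j + 2))]
    _ ≤ K := by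
        simpa using mul_le_mul_of_nonneg_left (sum_inv_mul_succ_le t) hK

/-! ### The Poisson equation of a finite irreducible chain -/

section Poisson

variable {S : Type*} [Fintype S]

theorem FiniteChain.nonneg (c : FiniteChain S) (s s' : S) : 0 ≤ c.P s s' :=
  c.irreducible.nonneg s s'

theorem FiniteChain.mulVec_one (c : FiniteChain S) : c.P.mulVec 1 = 1 := by
  ext s
  simpa [Matrix.mulVec, dotProduct] using c.row_sum s

/-- Harmonic functions of an irreducible chain are constant. -/
theorem FiniteChain.harmonic_const (c : FiniteChain S) {f : S → ℝ} (hf : c.P.mulVec f = f)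
    (i j : S) : f i = f j := by
  classical
  have hpow : ∀ (g : S → ℝ), c.P.mulVec g = g → ∀ k : ℕ, (c.P ^ k).mulVec g = g := by
    intro g hg k
    induction k with
    | zero => simp
    | succ k ih => rw [pow_succ, ← Matrix.mulVec_mulVec, hg, ih]
  have hnn : ∀ k : ℕ, ∀ a b, 0 ≤ (c.P ^ k) a b := by
    intro k
    induction k with
    | zero => intro a b; by_cases h : a = b <;> simp [h]
    | succ k ih =>
      intro a b
      rw [pow_succ, Matrix.mul_apply]
      exact Finset.sum_nonneg fun x _ => mul_nonneg (ih a x) (c.nonneg x b)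
  obtain ⟨m, -, hm⟩ := Finset.exists_max_image Finset.univ f ⟨i, Finset.mem_univ i⟩
  have key : ∀ j, f j = f m := by
    intro j
    obtain ⟨k, -, hk⟩ := (Matrix.isIrreducible_iff_exists_pow_pos c.nonneg).1 c.irreducible m j
    have h1 := congrFun (hpow 1 c.mulVec_one k) m
    have h2 := congrFun (hpow f hf k) m
    simp only [Matrix.mulVec, dotProduct, Pi.one_apply, mul_one] at h1 h2
    have h3 : ∑ x, (c.P ^ k) m x * (f m - f x) = 0 := by
      simp only [mul_sub, Finset.sum_sub_distrib, ← Finset.sum_mul, h1, h2]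
      ring
    have h4 := (Finset.sum_eq_zero_iff_of_nonneg fun x _ =>
      mul_nonneg (hnn k m x) (sub_nonneg.2 (hm x (Finset.mem_univ x)))).1 h3 j (Finset.mem_univ j)
    rcases mul_eq_zero.1 h4 with h | h
    · exact absurd h hk.ne'
    · linarith
  rw [key i, key j]

/-- The Poisson equation `g - P g = f - π f` is solvable. -/
theorem FiniteChain.exists_poisson (c : FiniteChain S) (f : S → ℝ) :
    ∃ g : S → ℝ, ∀ s, g s - ∑ s', c.P s s' * g s' = f s - ∑ s', c.stat s' * f s' := by
  classical
  have hne : Nonempty S := by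
    by_contra h
    rw [not_nonempty_iff] at h
    simpa using c.stat_sum
  let T : (S → ℝ) →ₗ[ℝ] (S → ℝ) := LinearMap.id - c.P.mulVecLin
  let φ : (S → ℝ) →ₗ[ℝ] ℝ :=
    { toFun := fun f => ∑ s, c.stat s * f s
      map_add' := fun f g => by simp [mul_add, Finset.sum_add_distrib]
      map_smul' := fun r f => by
        simp only [Pi.smul_apply, smul_eq_mul, Finset.mul_sum, RingHom.id_apply]
        exact Finset.sum_congr rfl fun s _ => by ring }
  have hTapp : ∀ g s, T g s = g s - ∑ s', c.P s s' * g s' := fun g s => rfl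
  have hφ : ∀ g, φ g = ∑ s, c.stat s * g s := fun g => rfl
  have hle : LinearMap.range T ≤ LinearMap.ker φ := by
    rintro _ ⟨g, rfl⟩
    rw [LinearMap.mem_ker, hφ]
    simp only [hTapp, mul_sub, Finset.sum_sub_distrib, Finset.mul_sum]
    rw [Finset.sum_comm]
    simp only [← mul_assoc, ← Finset.sum_mul, c.stationary, sub_self]
  have hker : LinearMap.ker T ≤ Submodule.span ℝ {(1 : S → ℝ)} := by
    intro g hg
    have hg' : c.P.mulVec g = g := by
      have h : T g = 0 := hg
      ext s
      have := congrFun h s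
      rw [hTapp] at this
      exact (sub_eq_zero.1 this).symm
    obtain ⟨s₀⟩ := hne
    refine Submodule.mem_span_singleton.2 ⟨g s₀, ?_⟩
    ext s
    simpa using c.harmonic_const hg' s₀ s
  have hkdim : Module.finrank ℝ (LinearMap.ker T) ≤ 1 :=
    (Submodule.finrank_mono hker).trans (finrank_span_singleton one_ne_zero).le
  have hφ1 : φ 1 = 1 := by simpa [hφ] using c.stat_sum
  have hφr : LinearMap.range φ = ⊤ := LinearMap.range_eq_top.2 fun r => ⟨r • 1, by simp [hφ1]⟩
  have e1 := LinearMap.finrank_range_add_finrank_ker T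
  have e2 := LinearMap.finrank_range_add_finrank_ker φ
  rw [hφr, finrank_top, Module.finrank_self] at e2
  have heq : LinearMap.range T = LinearMap.ker φ :=
    Submodule.eq_of_le_of_finrank_le hle (by omega)
  have hmem : f - φ f • (1 : S → ℝ) ∈ LinearMap.ker φ := by simp [hφ1]
  rw [← heq] at hmem
  obtain ⟨g, hg⟩ := hmem
  refine ⟨g, fun s => ?_⟩
  rw [← hTapp, hg]
  simp [hφ]

/-- The Poisson equation for vector-valued functions. -/
theorem FiniteChain.exists_poisson_vec {M : ℕ} (c : FiniteChain S) (f : S → Vec M) :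
    ∃ g : S → Vec M, ∀ s, g s - ∑ s', c.P s s' • g s' = f s - ∑ s', c.stat s' • f s' := by
  choose g hg using fun m : Fin M => c.exists_poisson fun s => f s m
  refine ⟨fun s => WithLp.toLp 2 fun m => g m s, fun s => ?_⟩
  ext m
  simpa [WithLp.ofLp_sum] using hg m s

end Poisson

/-! ### Calculus on the orthant -/

section Potential

variable {M : ℕ}

theorem toVec_mem_orthant (x : Fin M → ℕ) : toVec x ∈ orthant M := fun m => by simp [toVec]

theorem convex_orthant : Convex ℝ (orthant M) := by
  intro x hx y hy a b ha hb _ m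
  simpa using add_nonneg (mul_nonneg ha (hx m)) (mul_nonneg hb (hy m))

theorem abs_apply_le_norm (x : Vec M) (m : Fin M) : |x m| ≤ ‖x‖ := by
  simpa using PiLp.norm_apply_le x m

/-- The vector all of whose coordinates are `1`. -/
def ones (M : ℕ) : Vec M := WithLp.toLp 2 fun _ => 1

theorem add_ones_add_mem_orthant {X u : Vec M} (hX : X ∈ orthant M) (hu : ‖u‖ ≤ 1) :
    X + (ones M + u) ∈ orthant M := by
  intro m
  have h1 := (abs_le.1 ((abs_apply_le_norm u m).trans hu)).1
  have h2 := hX m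
  simp only [ones, PiLp.add_apply]
  linarith

theorem uniqueDiffOn_orthant : UniqueDiffOn ℝ (orthant M) := by
  refine uniqueDiffOn_convex convex_orthant ⟨ones M, ?_⟩
  rw [mem_interior_iff_mem_nhds]
  refine Filter.mem_of_superset (Metric.closedBall_mem_nhds (ones M) one_pos) fun y hy => ?_
  have h : ‖y - ones M‖ ≤ 1 := by simpa [dist_eq_norm] using hy
  have := add_ones_add_mem_orthant (X := 0) (fun m => le_rfl) h
  simpa using this

theorem eventually_atInfinity {p : Vec M → Prop} :
    (∀ᶠ X in atInfinity M, p X) ↔ ∃ K, ∀ X ∈ orthant M, K ≤ ‖X‖ → p X := by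
  rw [atInfinity, eventually_inf_principal, hasBasis_cobounded_norm.eventually_iff]
  constructor
  · rintro ⟨K, -, h⟩
    exact ⟨K, fun X hX hK => h hK hX⟩
  · rintro ⟨K, h⟩
    exact ⟨K, trivial, fun X hK hX => h X hX hK⟩

/-- What holds at infinity holds at infinity in a neighbourhood of bounded size. -/
theorem eventually_shift {p : Vec M → Prop} (h : ∀ᶠ X in atInfinity M, p X) (B : ℝ) :
    ∀ᶠ X in atInfinity M, ∀ Y : Vec M, ‖Y‖ ≤ B → X + Y ∈ orthant M → p (X + Y) := by
  obtain ⟨K, hK⟩ := eventually_atInfinity.1 h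
  refine eventually_atInfinity.2 ⟨K + B, fun X _ hX Y hY hXY => hK _ hXY ?_⟩
  have := norm_sub_norm_le X (-Y)
  rw [norm_neg, sub_neg_eq_add] at this
  linarith

theorem eventually_mem_orthant : ∀ᶠ X in atInfinity M, X ∈ orthant M :=
  eventually_atInfinity.2 ⟨0, fun _ hX _ => hX⟩

theorem tendsto_norm_atInfinity : Tendsto (fun X : Vec M => ‖X‖) (atInfinity M) atTop :=
  tendsto_norm_cobounded_atTop.mono_left inf_le_left

theorem inner_grad {G : Vec M → ℝ} (X Y : Vec M) :
    ⟪grad G X, Y⟫_ℝ = fderivWithin ℝ G (orthant M) X Y := by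
  simp [grad, gradientWithin]

theorem norm_grad (G : Vec M → ℝ) (X : Vec M) : ‖grad G X‖ = ‖fderivWithin ℝ G (orthant M) X‖ := by
  simp [grad, gradientWithin]

theorem norm_grad_sub (G : Vec M → ℝ) (X Y : Vec M) : ‖grad G X - grad G Y‖ =
    ‖fderivWithin ℝ G (orthant M) X - fderivWithin ℝ G (orthant M) Y‖ := by
  rw [grad, grad, gradientWithin, gradientWithin, ← map_sub, LinearIsometryEquiv.norm_map]

/-- A function whose derivative is negligible with respect to the function is nearly constant
on bounded neighbourhoods of infinity. -/
theorem eventually_norm_sub_le {E : Type*} [NormedAddCommGroup E] [NormedSpace ℝ E] {F : Vec M → E}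
    (hF : DifferentiableOn ℝ F (orthant M))
    (ho : (fun X => fderivWithin ℝ F (orthant M) X) =o[atInfinity M] F) {B ε : ℝ} (hB : 0 < B)
    (hε : 0 < ε) : ∀ᶠ X in atInfinity M, ∀ Y : Vec M, ‖Y‖ ≤ B → X + Y ∈ orthant M →
      ‖F (X + Y) - F X‖ ≤ ε * ‖F X‖ := by
  set η := min (ε / (2 * B)) (1 / (2 * B)) with hη
  have hη0 : 0 < η := by positivity
  have hη1 : η * B ≤ 1 / 2 := by
    calc η * B ≤ 1 / (2 * B) * B := by gcongr; exact min_le_right _ _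
      _ = 1 / 2 := by field_simp
  have hη2 : η * B * 2 ≤ ε := by
    calc η * B * 2 ≤ ε / (2 * B) * B * 2 := by gcongr; exact min_le_left _ _
      _ = ε := by field_simp
  filter_upwards [eventually_shift (ho.bound hη0) B, eventually_mem_orthant] with X hX hXo Y hY hXY
  have hseg : segment ℝ X (X + Y) ⊆ orthant M := convex_orthant.segment_subset hXo hXY
  have hdist : ∀ Z ∈ segment ℝ X (X + Y), ‖Z - X‖ ≤ B := by
    intro Z hZ
    rw [segment_eq_image'] at hZ
    obtain ⟨θ, hθ, rfl⟩ := hZ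
    simp only [add_sub_cancel_left, norm_smul, Real.norm_of_nonneg hθ.1]
    nlinarith [hθ.1, hθ.2, norm_nonneg Y]
  have hcomp : IsCompact (segment ℝ X (X + Y)) := by
    rw [segment_eq_image']
    exact isCompact_Icc.image (by fun_prop)
  obtain ⟨Z₀, hZ₀, hmax⟩ := hcomp.exists_isMaxOn ⟨X, left_mem_segment ℝ X _⟩
    (hF.continuousOn.mono hseg).norm
  have hder : ∀ Z ∈ segment ℝ X (X + Y), ‖F Z - F X‖ ≤ η * B * ‖F Z₀‖ := by
    intro Z hZ
    have h := Convex.norm_image_sub_le_of_norm_hasFDerivWithin_le (𝕜 := ℝ) (C := η * ‖F Z₀‖)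
      (fun W hW => ((hF W (hseg hW)).hasFDerivWithinAt.mono hseg))
      (fun W hW => ?_) (convex_segment X (X + Y)) (left_mem_segment ℝ X _) hZ
    · calc ‖F Z - F X‖ ≤ η * ‖F Z₀‖ * ‖Z - X‖ := h
        _ ≤ η * ‖F Z₀‖ * B := by gcongr; exact hdist Z hZ
        _ = _ := by ring
    · have h2 := hX (W - X) (hdist W hW) (by simpa using hseg hW)
      rw [add_sub_cancel] at h2
      exact h2.trans (mul_le_mul_of_nonneg_left (hmax hW) hη0.le)
  have hZ : ‖F Z₀‖ ≤ 2 * ‖F X‖ := by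
    have h1 := hder Z₀ hZ₀
    have h2 := norm_sub_norm_le (F Z₀) (F X)
    nlinarith [norm_nonneg (F Z₀)]
  calc ‖F (X + Y) - F X‖ ≤ η * B * ‖F Z₀‖ := hder _ (right_mem_segment ℝ X _)
    _ ≤ η * B * (2 * ‖F X‖) := by gcongr
    _ = η * B * 2 * ‖F X‖ := by ring
    _ ≤ ε * ‖F X‖ := by gcongr

variable {R : Matrix (Fin M) (Fin M) ℝ} {G : Vec M → ℝ}

theorem IsPrePotential.eventually_mul_norm_le (hG : IsPrePotential R G) (c : ℝ) :
    ∀ᶠ X in atInfinity M, c * ‖X‖ ≤ G X := by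
  filter_upwards [hG.superlinear.eventually_ge_atTop c,
    tendsto_norm_atInfinity.eventually_gt_atTop 0] with X h1 h2
  exact (le_div_iff₀ h2).1 h1

theorem IsPrePotential.tendsto_atTop (hG : IsPrePotential R G) :
    Tendsto G (atInfinity M) atTop :=
  tendsto_atTop_mono' _ ((hG.eventually_mul_norm_le 1).mono fun X h => by simpa using h)
    tendsto_norm_atInfinity

/-- A superlinear function has no bounded gradient. -/
theorem IsPrePotential.grad_unbounded [NeZero M] (hG : IsPrePotential R G)
    (hd : DifferentiableOn ℝ G (orthant M)) (K : ℝ) : ¬ ∀ᶠ X in atInfinity M, ‖grad G X‖ ≤ K := by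
  intro h
  obtain ⟨r, hr⟩ := eventually_atInfinity.1 h
  set e : Vec M := EuclideanSpace.single 0 1 with he
  have hen : ‖e‖ = 1 := by simp [he]
  have hray : ∀ s : ℝ, 0 ≤ s → s • e ∈ orthant M := by
    intro s hs m
    by_cases h : m = 0 <;> simp [he, h, hs]
  set r₀ := max r 0
  have hr0 : 0 ≤ r₀ := le_max_right _ _
  have hlin : ∀ s, r₀ ≤ s → G (s • e) ≤ G (r₀ • e) + K * (s - r₀) := by
    intro s hs
    set T : Set (Vec M) := segment ℝ (r₀ • e) (s • e)
    have hT : ∀ W ∈ T, W ∈ orthant M ∧ r ≤ ‖W‖ := by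
      rintro W ⟨a, b, ha, hb, hab, rfl⟩
      have heq : a • r₀ • e + b • s • e = (a * r₀ + b * s) • e := by
        rw [add_smul, mul_smul, mul_smul]
      have h2 : r₀ ≤ a * r₀ + b * s := by
        calc r₀ = a * r₀ + b * r₀ := by rw [← add_mul, hab, one_mul]
          _ ≤ _ := by gcongr
      rw [heq]
      refine ⟨hray _ (hr0.trans h2), ?_⟩
      rw [norm_smul, hen, mul_one, Real.norm_of_nonneg (hr0.trans h2)]
      exact (le_max_left _ _).trans h2
    have h := Convex.norm_image_sub_le_of_norm_hasFDerivWithin_le (𝕜 := ℝ) (C := K) (s := T)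
      (fun W hW => ((hd W (hT W hW).1).hasFDerivWithinAt.mono fun V hV => (hT V hV).1))
      (fun W hW => by rw [← norm_grad]; exact hr W (hT W hW).1 (hT W hW).2)
      (convex_segment _ _) (left_mem_segment ℝ _ _) (right_mem_segment ℝ _ _)
    rw [← sub_smul, norm_smul, hen, mul_one, Real.norm_of_nonneg (sub_nonneg.2 hs)] at h
    linarith [(abs_le.1 h).2]
  obtain ⟨r₁, hr₁⟩ := eventually_atInfinity.1 (hG.eventually_mul_norm_le (|K| + 1))
  set s := max (max r₀ r₁) (|G (r₀ • e)| + 1)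
  have hs0 : r₀ ≤ s := (le_max_left _ _).trans (le_max_left _ _)
  have hs : ‖s • e‖ = s := by
    rw [norm_smul, hen, mul_one, Real.norm_of_nonneg (hr0.trans hs0)]
  have h1 := hr₁ (s • e) (hray s (hr0.trans hs0))
    (by rw [hs]; exact (le_max_right _ _).trans (le_max_left _ _))
  rw [hs] at h1
  have h2 := hlin s hs0
  have h3 : |G (r₀ • e)| + 1 ≤ s := le_max_right _ _
  have h4 : K * (s - r₀) ≤ |K| * s := by
    calc K * (s - r₀) ≤ |K| * (s - r₀) := by
          gcongr
          exact le_abs_self K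
      _ ≤ |K| * s := by gcongr; linarith
  linarith [le_abs_self (G (r₀ • e))]

theorem IsStrongPotential.isLittleO (hG : IsStrongPotential R G) :
    ((fun X => fderivWithin ℝ G (orthant M) X) =o[atInfinity M] G) ∧
    ((fun X => fderivWithin ℝ (fderivWithin ℝ G (orthant M)) (orthant M) X) =o[atInfinity M]
      fun X => fderivWithin ℝ G (orthant M) X) := by
  rcases Nat.eq_zero_or_pos M with rfl | hM
  · have hbot : atInfinity 0 = ⊥ := by
      rw [← Filter.empty_mem_iff_bot]
      change ∀ᶠ X in atInfinity 0, X ∈ (∅ : Set (Vec 0))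
      refine eventually_atInfinity.2 ⟨1, fun X _ hX => ?_⟩
      rw [Subsingleton.elim X 0, norm_zero] at hX
      exact absurd hX (by norm_num)
    rw [hbot]
    exact ⟨Asymptotics.isLittleO_bot _ _, Asymptotics.isLittleO_bot _ _⟩
  have : NeZero M := ⟨hM.ne'⟩
  have hd : DifferentiableOn ℝ G (orthant M) := hG.contDiffOn.differentiableOn (by simp)
  obtain ⟨h₀, ⟨K, hK⟩, ho⟩ := hG.polynomial
  have hNB : (atInfinity M).NeBot := ⟨fun h => hG.grad_unbounded hd 0 (by rw [h]; trivial)⟩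
  have h1 : ∀ X ∈ orthant M, ‖iteratedFDerivWithin ℝ 1 G (orthant M) X‖ =
      ‖fderivWithin ℝ G (orthant M) X‖ := fun X hX =>
    norm_iteratedFDerivWithin_one G (uniqueDiffOn_orthant X hX)
  have h2 : 2 ≤ h₀ := by
    by_contra h
    obtain rfl | rfl : h₀ = 0 ∨ h₀ = 1 := by omega
    · obtain ⟨X, hX, hX'⟩ := (hK.and (hG.tendsto_atTop.eventually_ge_atTop (K + 1))).exists
      rw [norm_iteratedFDerivWithin_zero] at hX
      linarith [Real.le_norm_self (G X)]
    · refine hG.grad_unbounded hd K ?_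
      filter_upwards [hK, eventually_mem_orthant] with X hX hXo
      rwa [norm_grad, ← h1 X hXo]
  constructor
  · refine Asymptotics.IsLittleO.of_bound fun c hc => ?_
    filter_upwards [(ho 0 (by omega)).bound hc, eventually_mem_orthant] with X hX hXo
    rwa [norm_iteratedFDerivWithin_zero, zero_add, h1 X hXo] at hX
  · refine Asymptotics.IsLittleO.of_bound fun c hc => ?_
    filter_upwards [(ho 1 (by omega)).bound hc, eventually_mem_orthant] with X hX hXo
    rwa [h1 X hXo, ← norm_iteratedFDerivWithin_fderivWithin uniqueDiffOn_orthant hXo,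
      norm_iteratedFDerivWithin_one _ (uniqueDiffOn_orthant X hXo)] at hX

/-- Strong potentials are weak potentials. -/
theorem IsStrongPotential.isWeakPotential (hG : IsStrongPotential R G) : IsWeakPotential R G where
  toIsPrePotential := hG.toIsPrePotential
  contDiffOn := hG.contDiffOn.of_le (WithTop.coe_le_coe.2 (le_top : (2 : ℕ∞) ≤ ⊤))
  subexp B hB ε hε := by
    have hd : DifferentiableOn ℝ G (orthant M) := hG.contDiffOn.differentiableOn (by simp)
    filter_upwards [eventually_norm_sub_le hd hG.isLittleO.1 hB hε,
      hG.tendsto_atTop.eventually_gt_atTop 0] with X hX hpos Y hY hXY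
    have h := hX Y hY hXY
    rw [Real.norm_eq_abs, Real.norm_of_nonneg hpos.le] at h
    rw [div_sub_one hpos.ne', abs_div, abs_of_pos hpos]
    exact (div_le_iff₀ hpos).2 h
  subexp_grad B hB ε hε := by
    have hd : DifferentiableOn ℝ (fderivWithin ℝ G (orthant M)) (orthant M) :=
      (hG.contDiffOn.fderivWithin (m := 1) uniqueDiffOn_orthant
        (WithTop.coe_le_coe.2 (le_top : (1 + 1 : ℕ∞) ≤ ⊤))).differentiableOn one_ne_zero
    filter_upwards [eventually_norm_sub_le hd hG.isLittleO.2 hB hε] with X hX Y hY hXY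
    rw [norm_grad_sub, norm_grad]
    exact hX Y hY hXY

/-- First-order expansion of a weak potential at infinity. -/
theorem IsWeakPotential.linearization (hG : IsWeakPotential R G) {B ε : ℝ} (hB : 0 < B)
    (hε : 0 < ε) : ∀ᶠ X in atInfinity M, ∀ Y : Vec M, ‖Y‖ ≤ B → X + Y ∈ orthant M →
      |G (X + Y) - G X - ⟪grad G X, Y⟫_ℝ| ≤ ε * ‖grad G X‖ := by
  have hd : DifferentiableOn ℝ G (orthant M) := hG.contDiffOn.differentiableOn (by simp)
  filter_upwards [hG.subexp_grad B hB (ε / B) (by positivity), eventually_mem_orthant]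
    with X hX hXo Y hY hXY
  have hseg : segment ℝ X (X + Y) ⊆ orthant M := convex_orthant.segment_subset hXo hXY
  have h := Convex.norm_image_sub_le_of_norm_hasFDerivWithin_le' (𝕜 := ℝ)
    (C := ε / B * ‖grad G X‖) (φ := fderivWithin ℝ G (orthant M) X)
    (fun W hW => ((hd W (hseg hW)).hasFDerivWithinAt.mono hseg))
    (fun W hW => ?_) (convex_segment X (X + Y)) (left_mem_segment ℝ X _) (right_mem_segment ℝ X _)
  · rw [add_sub_cancel_left, Real.norm_eq_abs, ← inner_grad] at h
    calc _ ≤ ε / B * ‖grad G X‖ * ‖Y‖ := h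
      _ ≤ ε / B * ‖grad G X‖ * B := by gcongr
      _ = ε * ‖grad G X‖ := by field_simp
  · rw [← norm_grad_sub]
    have hW' : ‖W - X‖ ≤ B := by
      rw [segment_eq_image'] at hW
      obtain ⟨θ, hθ, rfl⟩ := hW
      simp only [add_sub_cancel_left, norm_smul, Real.norm_of_nonneg hθ.1]
      nlinarith [hθ.1, hθ.2, norm_nonneg Y]
    simpa using hX (W - X) hW' (by simpa using hseg hW)

/-- The gradient of a weak potential is negligible with respect to the potential. -/
theorem IsWeakPotential.norm_grad_le (hG : IsWeakPotential R G) {ε : ℝ} (hε : 0 < ε) :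
    ∀ᶠ X in atInfinity M, ‖grad G X‖ ≤ ε * G X := by
  set B := ‖ones M‖ + 1
  have hB : 0 < B := by positivity
  filter_upwards [hG.linearization hB (ε := 1 / 4) (by norm_num),
    hG.subexp B hB (ε / 4) (by positivity), hG.tendsto_atTop.eventually_gt_atTop 0,
    eventually_mem_orthant] with X hl hs hpos hX
  set u : Vec M := (‖grad G X‖)⁻¹ • grad G X with hu
  have hu1 : ‖u‖ ≤ 1 := by
    rw [hu, norm_smul, norm_inv, norm_norm]
    exact inv_mul_le_one
  have hgu : ⟪grad G X, u⟫_ℝ = ‖grad G X‖ := by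
    rw [hu, inner_smul_right, real_inner_self_eq_norm_sq]
    rcases eq_or_ne (‖grad G X‖) 0 with h | h
    · simp [h]
    · field_simp
  have hY : ∀ v : Vec M, ‖v‖ ≤ 1 → |⟪grad G X, ones M + v⟫_ℝ| ≤
      ε / 4 * G X + 1 / 4 * ‖grad G X‖ := by
    intro v hv
    have hn : ‖ones M + v‖ ≤ B := (norm_add_le _ _).trans (add_le_add le_rfl hv)
    have ho := add_ones_add_mem_orthant hX hv
    have h1 := hl _ hn ho
    have h2 := hs _ hn ho
    rw [div_sub_one hpos.ne', abs_div, abs_of_pos hpos, div_le_iff₀ hpos] at h2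
    rw [abs_le] at h1 h2 ⊢
    constructor <;> linarith
  have h1 := (abs_le.1 (hY u hu1)).2
  have h2 := (abs_le.1 (hY 0 (by simp))).1
  rw [inner_add_right, hgu] at h1
  rw [add_zero] at h2
  linarith

/-- Second-order bound for powers. -/
theorem exists_add_pow_le (m : ℕ) : ∃ c : ℝ, 0 ≤ c ∧ ∀ a d η : ℝ, 0 ≤ a → 0 ≤ η → η ≤ 1 →
    |d| ≤ η * a → (a + d) ^ (m + 1) ≤ a ^ (m + 1) + (m + 1) * a ^ m * d + c * η * a ^ m * |d| := by
  induction m with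
  | zero => exact ⟨0, le_rfl, fun a d η _ _ _ _ => by simp⟩
  | succ m ih =>
    obtain ⟨c, hc, ih⟩ := ih
    refine ⟨m + 1 + 2 * c, by positivity, fun a d η ha hη hη1 hd => ?_⟩
    have hda : |d| ≤ a := hd.trans (mul_le_of_le_one_left ha hη1)
    have h0 : 0 ≤ a + d := by linarith [neg_abs_le d]
    have h1 := mul_le_mul_of_nonneg_left (ih a d η ha hη hη1 hd) h0
    have hd2 : d ^ 2 ≤ η * a * |d| := by
      rw [← sq_abs, sq]
      exact mul_le_mul_of_nonneg_right hd (abs_nonneg d)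
    have h2 : ((m : ℝ) + 1) * a ^ m * d ^ 2 ≤ (m + 1) * a ^ m * (η * a * |d|) := by gcongr
    have h3 : c * η * a ^ m * |d| * (a + d) ≤ c * η * a ^ m * |d| * (2 * a) := by
      gcongr
      linarith [le_abs_self d]
    push_cast
    calc (a + d) ^ (m + 1 + 1) = (a + d) * (a + d) ^ (m + 1) := by ring
      _ ≤ _ := h1
      _ = a ^ (m + 1 + 1) + (m + 1 + 1) * a ^ (m + 1) * d + (m + 1) * a ^ m * d ^ 2
          + c * η * a ^ m * |d| * (a + d) := by ring
      _ ≤ a ^ (m + 1 + 1) + (m + 1 + 1) * a ^ (m + 1) * d + (m + 1) * a ^ m * (η * a * |d|)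
          + c * η * a ^ m * |d| * (2 * a) := by linarith
      _ = _ := by ring

/-- The potential with a first-order correction `ψ`. -/
def corrected (G : Vec M → ℝ) (X ψ : Vec M) : ℝ := G X + ⟪grad G X, ψ⟫_ℝ

theorem IsWeakPotential.norm_le_corrected (hG : IsWeakPotential R G) {B : ℝ} (hB : 0 < B) :
    ∀ᶠ X in atInfinity M, ∀ ψ : Vec M, ‖ψ‖ ≤ B →
      ‖X‖ ≤ corrected G X ψ ∧ G X ≤ 2 * corrected G X ψ := by
  filter_upwards [hG.norm_grad_le (ε := 1 / (2 * B)) (by positivity),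
    hG.eventually_mul_norm_le 2] with X h1 h2 ψ hψ
  have h3 : |⟪grad G X, ψ⟫_ℝ| ≤ G X / 2 := by
    calc |⟪grad G X, ψ⟫_ℝ| ≤ ‖grad G X‖ * ‖ψ‖ := abs_real_inner_le_norm _ _
      _ ≤ ‖grad G X‖ * B := by gcongr
      _ ≤ 1 / (2 * B) * G X * B := by gcongr
      _ = G X / 2 := by field_simp
  have h4 := (abs_le.1 h3).1
  simp only [corrected]
  constructor <;> linarith

/-- One-step expansion of the powers of the corrected potential. -/
theorem IsWeakPotential.corrected_pow_le (hG : IsWeakPotential R G) {B ε : ℝ} (hB : 0 < B)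
    (hε : 0 < ε) (m : ℕ) : ∀ᶠ X in atInfinity M, ∀ Y ψ ψ' : Vec M, ‖Y‖ ≤ B → ‖ψ‖ ≤ B → ‖ψ'‖ ≤ B →
      X + Y ∈ orthant M → |corrected G (X + Y) ψ'| ^ (m + 1) ≤ |corrected G X ψ| ^ (m + 1)
        + (m + 1) * |corrected G X ψ| ^ m * ⟪grad G X, Y + ψ' - ψ⟫_ℝ
        + ε * |corrected G X ψ| ^ m * ‖grad G X‖ := by
  obtain ⟨c, hc, hpow⟩ := exists_add_pow_le m
  set η := min (ε / (4 * (m + 1))) 1 with hη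
  have hη0 : 0 < η := by positivity
  set b := 3 * B + 1 with hb
  have hb0 : 0 < b := by positivity
  set θ := min 1 (ε / (2 * (c + 1) * b)) with hθ
  have hθ0 : 0 < θ := by positivity
  filter_upwards [hG.linearization hB (half_pos hη0),
    hG.subexp_grad B hB (η / (2 * B)) (by positivity),
    hG.norm_grad_le (ε := θ / (2 * b)) (by positivity), hG.norm_le_corrected hB]
    with X hl hs hg hL Y ψ ψ' hY hψ hψ' hXY
  set g := ‖grad G X‖ with hgdef
  have hg0 : 0 ≤ g := norm_nonneg _
  set L := corrected G X ψ with hLdef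
  have hL0 : 0 ≤ L := (norm_nonneg _).trans (hL ψ hψ).1
  set z := ⟪grad G X, Y + ψ' - ψ⟫_ℝ with hz
  set d := corrected G (X + Y) ψ' - L with hd
  -- the error of the first-order expansion
  have herr : |d - z| ≤ η * g := by
    have e1 : d - z = (G (X + Y) - G X - ⟪grad G X, Y⟫_ℝ) + ⟪grad G (X + Y) - grad G X, ψ'⟫_ℝ := by
      simp only [hd, hz, hLdef, corrected, inner_add_right, inner_sub_right, inner_sub_left]
      ring
    have e2 : |⟪grad G (X + Y) - grad G X, ψ'⟫_ℝ| ≤ η / 2 * g := by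
      calc _ ≤ ‖grad G (X + Y) - grad G X‖ * ‖ψ'‖ := abs_real_inner_le_norm _ _
        _ ≤ (η / (2 * B) * g) * B := by gcongr; exact hs Y hY hXY
        _ = η / 2 * g := by field_simp
    rw [e1]
    calc _ ≤ _ := abs_add_le _ _
      _ ≤ η / 2 * g + η / 2 * g := add_le_add (hl Y hY hXY) e2
      _ = η * g := by ring
  have hzb : |z| ≤ 3 * B * g := by
    calc |z| ≤ g * ‖Y + ψ' - ψ‖ := abs_real_inner_le_norm _ _
      _ ≤ g * (3 * B) := by
          gcongr
          calc _ ≤ ‖Y + ψ'‖ + ‖ψ‖ := norm_sub_le _ _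
            _ ≤ ‖Y‖ + ‖ψ'‖ + ‖ψ‖ := by gcongr; exact norm_add_le _ _
            _ ≤ 3 * B := by linarith
      _ = _ := by ring
  have hdb : |d| ≤ b * g := by
    have e : d = (d - z) + z := by ring
    have h1 : η * g ≤ 1 * g := mul_le_mul_of_nonneg_right (min_le_right _ _) hg0
    have h2 : |d| ≤ |d - z| + |z| := by simpa using abs_add_le (d - z) z
    rw [hb]
    linarith
  have hgL : b * g ≤ θ * L := by
    calc b * g ≤ b * (θ / (2 * b) * G X) := by gcongr
      _ ≤ b * (θ / (2 * b) * (2 * L)) := by gcongr; exact (hL ψ hψ).2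
      _ = θ * L := by field_simp
  have hdL : |d| ≤ θ * L := hdb.trans hgL
  have hθ1 : θ ≤ 1 := min_le_left _ _
  have hL' : 0 ≤ L + d := by
    have : θ * L ≤ L := mul_le_of_le_one_left hL0 hθ1
    linarith [neg_abs_le d]
  have hLd : corrected G (X + Y) ψ' = L + d := by rw [hd]; ring
  rw [hLd, abs_of_nonneg hL', abs_of_nonneg hL0]
  have hp := hpow L d θ hL0 hθ0.le hθ1 hdL
  have hLm : 0 ≤ L ^ m := pow_nonneg hL0 m
  have t1 : ((m : ℝ) + 1) * L ^ m * d ≤ (m + 1) * L ^ m * z + ε / 4 * L ^ m * g := by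
    have e1 : d ≤ z + η * g := by linarith [(abs_le.1 herr).2]
    have e2 : (m + 1 : ℝ) * η ≤ ε / 4 := by
      calc (m + 1 : ℝ) * η ≤ (m + 1) * (ε / (4 * (m + 1))) := by gcongr; exact min_le_left _ _
        _ = ε / 4 := by field_simp
    calc ((m : ℝ) + 1) * L ^ m * d ≤ (m + 1) * L ^ m * (z + η * g) := by gcongr
      _ = (m + 1) * L ^ m * z + ((m + 1) * η) * (L ^ m * g) := by ring
      _ ≤ (m + 1) * L ^ m * z + ε / 4 * (L ^ m * g) := by gcongr
      _ = _ := by ring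
  have t2 : c * θ * L ^ m * |d| ≤ ε / 2 * L ^ m * g := by
    have e2 : c * θ * b ≤ ε / 2 := by
      calc c * θ * b ≤ (c + 1) * (ε / (2 * (c + 1) * b)) * b := by
            gcongr
            · linarith
            · exact min_le_right _ _
        _ = ε / 2 := by field_simp
    calc c * θ * L ^ m * |d| ≤ c * θ * L ^ m * (b * g) := by gcongr
      _ = (c * θ * b) * (L ^ m * g) := by ring
      _ ≤ ε / 2 * (L ^ m * g) := by gcongr
      _ = _ := by ring
  have t3 : 0 ≤ ε * L ^ m * g := by positivity
  linarith

end Potential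

/-! ### Departures and the policy -/

section Policy

variable {M : ℕ} {SD : Type*}

/-- The net effect `D (I - R)` of the departures `D` on the queues. -/
def flow (R : Matrix (Fin M) (Fin M) ℝ) : Vec M →L[ℝ] Vec M :=
  LinearMap.toContinuousLinearMap
    { toFun := fun D => WithLp.toLp 2 (Matrix.vecMul (WithLp.ofLp D) (1 - R))
      map_add' := fun D E => by simp [Matrix.add_vecMul]
      map_smul' := fun r D => by simp [Matrix.smul_vecMul] }

theorem flow_apply (R : Matrix (Fin M) (Fin M) ℝ) (D : Vec M) :
    flow R D = WithLp.toLp 2 (Matrix.vecMul (WithLp.ofLp D) (1 - R)) := rfl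

theorem inner_pressure (R : Matrix (Fin M) (Fin M) ℝ) (G : Vec M → ℝ) (X D : Vec M) :
    ⟪pressure R G X, D⟫_ℝ = ⟪grad G X, flow R D⟫_ℝ := by
  simp only [pressure, flow_apply, EuclideanSpace.inner_eq_star_dotProduct, star_trivial,
    Matrix.vecMul_transpose, Matrix.dotProduct_mulVec]

theorem norm_le_norm_of_abs_le {u v : Vec M} (h : ∀ m, |u m| ≤ |v m|) : ‖u‖ ≤ ‖v‖ := by
  rw [EuclideanSpace.norm_eq, EuclideanSpace.norm_eq]
  gcongr with m
  simpa using h m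

theorem ServiceConstraints.exists_bound [Finite SD] (C : ServiceConstraints M SD) :
    ∃ B > 0, ∀ s, ∀ Δ ∈ C.region s, ‖Δ‖ ≤ B := by
  have h : Bornology.IsBounded (⋃ s, C.region s) :=
    (Bornology.isBounded_iUnion).2 fun s => (C.isCompact_region s).isBounded
  obtain ⟨B, hB0, hB⟩ := h.exists_pos_norm_le
  exact ⟨B, hB0, fun s Δ hΔ => hB Δ (Set.mem_iUnion.2 ⟨s, hΔ⟩)⟩

/-- A linear functional is maximized over a region by a feasible departure vector. -/
theorem ServiceConstraints.exists_feasible_max (C : ServiceConstraints M SD) (s : SD) (p Δ : Vec M)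
    (hΔ : Δ ∈ C.region s) : ∃ D ∈ C.feasible s, ⟪p, Δ⟫_ℝ ≤ ⟪p, toVec D⟫_ℝ := by
  set l : StrongDual ℝ (Vec M) := innerSL ℝ p
  have hexp : IsExposed ℝ (C.region s) (l.toExposed (C.region s)) :=
    ContinuousLinearMap.toExposed.isExposed
  have hne : (l.toExposed (C.region s)).Nonempty := by
    obtain ⟨x, hx, hmax⟩ := (C.isCompact_region s).exists_isMaxOn ⟨Δ, hΔ⟩ l.continuous.continuousOn
    exact ⟨x, hx, fun y hy => hmax hy⟩
  obtain ⟨x, hx⟩ := (hexp.isCompact (C.isCompact_region s)).extremePoints_nonempty hne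
  obtain ⟨D, hD, rfl⟩ := C.vertex_feasible s (hexp.isExtreme.extremePoints_subset_extremePoints hx)
  exact ⟨D, hD, hx.1.2 Δ hΔ⟩

/-- Far from the origin, the choice of the policy nearly maximizes the scalar product with the
pressure over the whole service region. -/
theorem IsWeakPotential.policy_nearly_optimal [Finite SD] {R : Matrix (Fin M) (Fin M) ℝ}
    {G : Vec M → ℝ} (hG : IsWeakPotential R G) (C : ServiceConstraints M SD) {ε : ℝ} (hε : 0 < ε) :
    ∀ᶠ X in atInfinity M, ∀ x D : Fin M → ℕ, toVec x = X → ∀ s, IsMaxScalar R C G s x D →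
      ∀ Δ ∈ C.region s, ⟪grad G X, flow R Δ⟫_ℝ ≤ ⟪grad G X, flow R (toVec D)⟫_ℝ
        + ε * ‖grad G X‖ := by
  obtain ⟨B, hB, hBD⟩ := C.exists_bound
  set b := (‖flow R‖ + 1) * B with hb
  have hb0 : 0 < b := by positivity
  filter_upwards [hG.subexp_grad B hB (ε / b) (by positivity)] with X hX x D hx s hD Δ hΔ
  obtain ⟨E, hE, hΔE⟩ := C.exists_feasible_max s (pressure R G X) Δ hΔ
  have hEB : ‖toVec E‖ ≤ B := hBD s _ (C.feasible_subset s E hE)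
  have hopt : ⟪pressure R G X, toVec (E ⊓ x)⟫_ℝ ≤ ⟪pressure R G X, toVec D⟫_ℝ := by
    rw [← hx]
    exact hD.1 ⟨C.min_feasible s E hE x, inf_le_right⟩
  set v := toVec E - toVec (E ⊓ x) with hv
  have hvm : ∀ m, v m = (E m : ℝ) - min (E m : ℝ) (x m) := fun m => by simp [hv, toVec]
  set Y : Vec M := WithLp.toLp 2 fun m => if x m < E m then -(x m : ℝ) else 0 with hY
  have hXY : ∀ m, (X + Y) m = if x m < E m then 0 else (x m : ℝ) := by
    intro m
    rw [← hx]
    by_cases h : x m < E m <;> simp [hY, toVec, h]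
  have hYB : ‖Y‖ ≤ B := by
    refine (norm_le_norm_of_abs_le fun m => ?_).trans hEB
    by_cases h : x m < E m
    · simpa [hY, toVec, h] using h.le
    · simp [hY, h]
  have hXYo : X + Y ∈ orthant M := by
    intro m
    rw [hXY]
    split_ifs <;> positivity
  have hvo : v ∈ orthant M := by
    intro m
    rw [hvm]
    exact sub_nonneg.2 (min_le_left _ _)
  have hvB : ‖v‖ ≤ B := by
    refine (norm_le_norm_of_abs_le fun m => ?_).trans hEB
    rw [abs_of_nonneg (hvo m), hvm]
    have : (0 : ℝ) ≤ min (E m : ℝ) (x m) := le_min (Nat.cast_nonneg _) (Nat.cast_nonneg _)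
    simp only [toVec, Nat.abs_cast]
    linarith
  have horth : ⟪X + Y, v⟫_ℝ = 0 := by
    rw [PiLp.inner_apply]
    refine Finset.sum_eq_zero fun m _ => ?_
    rw [hXY, hvm]
    by_cases h : x m < E m
    · simp [h]
    · have : (E m : ℝ) ≤ x m := by exact_mod_cast not_lt.1 h
      simp [h, this]
  have h1 := hG.pressure_nonpos _ hXYo v hvo horth
  rw [inner_pressure] at h1
  have h2 : ⟪grad G X - grad G (X + Y), flow R v⟫_ℝ ≤ ε * ‖grad G X‖ := by
    calc _ ≤ ‖grad G X - grad G (X + Y)‖ * ‖flow R v‖ := real_inner_le_norm _ _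
      _ ≤ (ε / b * ‖grad G X‖) * ((‖flow R‖ + 1) * B) := by
          gcongr
          · rw [norm_sub_rev]; exact hX Y hYB hXYo
          · refine ((flow R).le_opNorm v).trans ?_
            gcongr
            linarith
      _ = ε * ‖grad G X‖ := by rw [← hb]; field_simp
  rw [inner_pressure, inner_pressure] at hopt hΔE
  have h3 : ⟪grad G X, flow R v⟫_ℝ ≤ ε * ‖grad G X‖ := by
    rw [inner_sub_left] at h2
    linarith
  rw [hv, map_sub, inner_sub_right] at h3
  linarith

/-- Under admissible rates, some stationary departures keep the drift of `G` negative. -/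
theorem IsPrePotential.exists_departures [Fintype SD] {R : Matrix (Fin M) (Fin M) ℝ}
    (hR : IsRouting R) {G : Vec M → ℝ} (hG : IsPrePotential R G) {C : ServiceConstraints M SD}
    {c : FiniteChain SD} {Λ : Vec M} (hΛ : IsAdmissible R C c Λ) :
    ∃ D : SD → Vec M, (∀ s, D s ∈ C.region s) ∧ ∃ δ > 0, ∀ᶠ X in atInfinity M,
      ⟪grad G X, Λ - flow R (∑ s, c.stat s • D s)⟫_ℝ ≤ -(δ * ‖grad G X‖) := by
  obtain ⟨D₀, -, c₀, hc₀, hD₀⟩ := hG.pressure_pos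
  obtain ⟨g₀, hg₀, hg⟩ := hG.grad_nondegenerate
  have hlim : Tendsto (fun r : ℝ => Λ + r • flow R D₀) (𝓝[>] 0) (𝓝 Λ) := by
    have : Tendsto (fun r : ℝ => Λ + r • flow R D₀) (𝓝 0) (𝓝 (Λ + (0 : ℝ) • flow R D₀)) :=
      Continuous.tendsto (by fun_prop) 0
    rw [zero_smul, add_zero] at this
    exact this.mono_left nhdsWithin_le_nhds
  obtain ⟨r, hr, hr0⟩ := ((hlim.eventually (mem_interior_iff_mem_nhds.1 hΛ)).and
    self_mem_nhdsWithin).exists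
  have hr0 : 0 < r := hr0
  obtain ⟨D, hD, hsum⟩ := hr
  refine ⟨D, hD, r * c₀, by positivity, ?_⟩
  have hunit : IsUnit (1 - R).det := (Matrix.isUnit_iff_isUnit_det _).1 hR.leaves.isUnit_one_sub
  have hflow : flow R (∑ s, c.stat s • D s) = Λ + r • flow R D₀ := by
    rw [← hsum, flow_apply]
    simp [Matrix.vecMul_vecMul, Matrix.nonsing_inv_mul _ hunit]
  filter_upwards [hD₀, hg] with X h1 h2
  rw [le_div_iff₀ (hg₀.trans_le h2), inner_pressure] at h1
  rw [hflow, sub_add_cancel_left, inner_neg_right, inner_smul_right, neg_le_neg_iff, mul_assoc]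
  gcongr

end Policy

/-! ### Arrivals -/

section Arrivals

variable {M : ℕ} {SA : Type*}

/-- The vectors of numbers of arrivals that are at most `B`. -/
def box (M B : ℕ) : Finset (Fin M → ℕ) := Fintype.piFinset fun _ => Finset.range (B + 1)

theorem mem_box {B : ℕ} {x : Fin M → ℕ} : x ∈ box M B ↔ ∀ m, x m ≤ B := by
  simp [box]

/-- The vector of average arrivals in a modulating state. -/
def Arrivals.mean (a : Arrivals M SA) (B : ℕ) (s : SA) : Vec M :=
  ∑ x ∈ box M B, (a.law s x).toReal • toVec x

theorem Arrivals.law_eq_zero {a : Arrivals M SA} {B : ℕ}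
    (hB : ∀ s, ∀ x ∈ (a.law s).support, ∀ m, x m ≤ B) (s : SA) {x : Fin M → ℕ}
    (hx : x ∉ box M B) : a.law s x = 0 := by
  by_contra h
  exact hx (mem_box.2 (hB s x ((PMF.mem_support_iff _ _).2 h)))

theorem Arrivals.sum_law {a : Arrivals M SA} {B : ℕ}
    (hB : ∀ s, ∀ x ∈ (a.law s).support, ∀ m, x m ≤ B) (s : SA) :
    ∑ x ∈ box M B, (a.law s x).toReal = 1 := by
  rw [← ENNReal.toReal_sum fun x _ => (a.law s).apply_ne_top x,
    ← tsum_eq_sum (L := .unconditional _) fun x hx => a.law_eq_zero hB s hx, PMF.tsum_coe,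
    ENNReal.toReal_one]

theorem Arrivals.sum_stat_mean [Fintype SA] {a : Arrivals M SA} {B : ℕ}
    (hB : ∀ s, ∀ x ∈ (a.law s).support, ∀ m, x m ≤ B) (c : FiniteChain SA) :
    ∑ s, c.stat s • a.mean B s = a.rate c := by
  ext m
  simp only [Arrivals.mean, Arrivals.rate, WithLp.ofLp_sum, WithLp.ofLp_smul, Finset.sum_apply,
    Pi.smul_apply, smul_eq_mul]
  refine Finset.sum_congr rfl fun s _ => ?_
  rw [tsum_eq_sum (s := box M B) fun x hx => by simp [a.law_eq_zero hB s hx]]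
  simp [toVec]

theorem Arrivals.sum_transition [Fintype SA] {SD : Type*} [Fintype SD] {a : Arrivals M SA} {B : ℕ}
    (hB : ∀ s, ∀ x ∈ (a.law s).support, ∀ m, x m ≤ B) (cA : FiniteChain SA) (cD : FiniteChain SD)
    (f : SA → Vec M) (g : SD → Vec M) (i : SA) (j : SD) :
    ∑ e ∈ box M B ×ˢ (Finset.univ : Finset (SA × SD)),
      ((a.law i e.1).toReal * cA.P i e.2.1 * cD.P j e.2.2) • (toVec e.1 + f e.2.1 - g e.2.2) =
    a.mean B i + ∑ i', cA.P i i' • f i' - ∑ j', cD.P j j' • g j' := by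
  have h1 := a.sum_law hB i
  have h2 := cA.row_sum i
  have h3 := cD.row_sum j
  simp only [smul_sub, smul_add, Finset.sum_sub_distrib, Finset.sum_add_distrib,
    Finset.sum_product, Fintype.sum_prod_type]
  congr 1
  · congr 1
    · simp only [← Finset.sum_smul, ← Finset.mul_sum, h2, h3, mul_one, Arrivals.mean]
    · simp only [← Finset.sum_smul, ← Finset.mul_sum, h3, mul_one]
      rw [Finset.sum_comm]
      simp only [← Finset.sum_smul, ← Finset.sum_mul, h1, one_mul]
  · rw [Finset.sum_congr rfl fun x _ => Finset.sum_comm, Finset.sum_comm]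
    simp only [← Finset.sum_smul, ← Finset.mul_sum, ← Finset.sum_mul, h1, h2, mul_one, one_mul]

theorem finite_norm_le (r : ℝ) : {x : Fin M → ℕ | ‖toVec x‖ ≤ r}.Finite := by
  refine (Finset.finite_toSet (box M ⌊r⌋₊)).subset fun x hx => mem_box.2 fun m => Nat.le_floor ?_
  have := (abs_apply_le_norm (toVec x) m).trans hx
  simpa [toVec] using this

theorem exists_abs_le {SD : Type*} [Finite SA] [Finite SD] (f : (Fin M → ℕ) → (Fin M → ℕ) → SA → SD → ℝ)
    (r : ℝ) : ∃ b, ∀ x d i j, ‖toVec x‖ ≤ r → ‖toVec d‖ ≤ r → |f x d i j| ≤ b := by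
  have hfin : ({x : Fin M → ℕ | ‖toVec x‖ ≤ r} ×ˢ ({d : Fin M → ℕ | ‖toVec d‖ ≤ r} ×ˢ
      (Set.univ : Set (SA × SD)))).Finite :=
    (finite_norm_le r).prod ((finite_norm_le r).prod Set.finite_univ)
  obtain ⟨b, hb⟩ := (hfin.image fun y => |f y.1 y.2.1 y.2.2.1 y.2.2.2|).bddAbove
  exact ⟨b, fun x d i j hx hd => hb ⟨(x, d, i, j), ⟨hx, hd, trivial⟩, rfl⟩⟩

end Arrivals

/-! ### The evolution of the network -/

section Network

set_option linter.unusedSectionVars false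

variable {M : ℕ} {SA SD : Type*} [Fintype SA] [Fintype SD]
  [MeasurableSpace SA] [MeasurableSingletonClass SA]
  [MeasurableSpace SD] [MeasurableSingletonClass SD]
  {R : Matrix (Fin M) (Fin M) ℝ} {C : ServiceConstraints M SD} {cA : FiniteChain SA}
  {cD : FiniteChain SD} {a : Arrivals M SA} {G : Vec M → ℝ}
  {Ω : Type*} [mΩ : MeasurableSpace Ω] {μ : Measure Ω} [IsProbabilityMeasure μ]
  {ℱ : Filtration ℕ mΩ} {X A D : ℕ → Ω → Fin M → ℕ} {sA : ℕ → Ω → SA} {sD : ℕ → Ω → SD}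

/-- The event that `x` customers arrive and that the chains jump to `i` and `j`. -/
def jump (A : ℕ → Ω → Fin M → ℕ) (sA : ℕ → Ω → SA) (sD : ℕ → Ω → SD) (t : ℕ)
    (e : (Fin M → ℕ) × SA × SD) : Set Ω :=
  {ω | A t ω = e.1 ∧ sA (t + 1) ω = e.2.1 ∧ sD (t + 1) ω = e.2.2}

namespace IsMaxScalarNetwork

theorem measurableSet_jump (h : IsMaxScalarNetwork R C cA cD a G μ ℱ X A D sA sD) (t : ℕ)
    (e : (Fin M → ℕ) × SA × SD) : MeasurableSet (jump A sA sD t e) := by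
  refine ℱ.le (t + 1) _ ?_
  exact (h.measurable_A t (measurableSet_singleton e.1)).inter
    ((h.measurable_sA (t + 1) (measurableSet_singleton e.2.1)).inter
      (h.measurable_sD (t + 1) (measurableSet_singleton e.2.2)))

theorem setIntegral_jump (h : IsMaxScalarNetwork R C cA cD a G μ ℱ X A D sA sD) (t : ℕ)
    (e : (Fin M → ℕ) × SA × SD) {u : Ω → ℝ} (hu : Measurable[ℱ t] u) (hi : Integrable u μ)
    {S : Set Ω} (hS : MeasurableSet[ℱ t] S) :
    ∫ ω in S, (jump A sA sD t e).indicator u ω ∂μ =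
      ∫ ω in S, (a.law (sA t ω) e.1).toReal * cA.P (sA t ω) e.2.1 * cD.P (sD t ω) e.2.2 * u ω ∂μ ∧
    Integrable (fun ω => (a.law (sA t ω) e.1).toReal * cA.P (sA t ω) e.2.1 *
      cD.P (sD t ω) e.2.2 * u ω) μ := by
  have hJ := h.measurableSet_jump t e
  have hmul : u * (jump A sA sD t e).indicator (fun _ => (1 : ℝ)) =
      (jump A sA sD t e).indicator u := by
    ext ω
    by_cases hω : ω ∈ jump A sA sD t e <;> simp [hω]
  have hi' : Integrable (u * (jump A sA sD t e).indicator fun _ => (1 : ℝ)) μ := by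
    rw [hmul]
    exact hi.indicator hJ
  have hc := (condExp_mul_of_stronglyMeasurable_left hu.stronglyMeasurable hi'
    ((integrable_const (1 : ℝ)).indicator hJ)).trans
    ((EventuallyEq.refl _ u).mul (h.transition t e.1 e.2.1 e.2.2))
  have hc' : μ[u * (jump A sA sD t e).indicator (fun _ => (1 : ℝ)) | ℱ t] =ᵐ[μ] fun ω =>
      (a.law (sA t ω) e.1).toReal * cA.P (sA t ω) e.2.1 * cD.P (sD t ω) e.2.2 * u ω := by
    filter_upwards [hc] with ω hω
    rw [hω, Pi.mul_apply, mul_comm]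
  refine ⟨?_, integrable_condExp.congr hc'⟩
  rw [← hmul, ← setIntegral_condExp (ℱ.le t) hi' hS]
  exact setIntegral_congr_ae (ℱ.le t _ hS) (hc'.mono fun ω hω _ => hω)

theorem ae_arrivals_mem_box (h : IsMaxScalarNetwork R C cA cD a G μ ℱ X A D sA sD) {B : ℕ}
    (hB : ∀ s, ∀ x ∈ (a.law s).support, ∀ m, x m ≤ B) (t : ℕ) : ∀ᵐ ω ∂μ, A t ω ∈ box M B := by
  have key : ∀ e : (Fin M → ℕ) × SA × SD, e.1 ∉ box M B → ∀ᵐ ω ∂μ, ω ∉ jump A sA sD t e := by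
    intro e he
    have h1 := (h.setIntegral_jump t e (u := fun _ => (1 : ℝ)) measurable_const
      (integrable_const 1) MeasurableSet.univ).1
    simp only [a.law_eq_zero hB _ he, ENNReal.toReal_zero, zero_mul, Measure.restrict_univ,
      integral_zero] at h1
    rw [integral_indicator_const _ (h.measurableSet_jump t e), smul_eq_mul, mul_one,
      measureReal_eq_zero_iff] at h1
    exact measure_eq_zero_iff_ae_notMem.1 h1
  have hall : ∀ᵐ ω ∂μ, ∀ e : (Fin M → ℕ) × SA × SD, e.1 ∉ box M B → ω ∉ jump A sA sD t e := by
    rw [ae_all_iff]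
    intro e
    by_cases he : e.1 ∈ box M B
    · exact ae_of_all _ fun ω hω => absurd he hω
    · filter_upwards [key e he] with ω hω _ using hω
  filter_upwards [hall] with ω hω
  by_contra hn
  exact hω (A t ω, sA (t + 1) ω, sD (t + 1) ω) hn ⟨rfl, rfl, rfl⟩

/-- Averaging over the arrivals and the jumps of the chains, given the past. -/
theorem setIntegral_transition (h : IsMaxScalarNetwork R C cA cD a G μ ℱ X A D sA sD) {B : ℕ}
    (hB : ∀ s, ∀ x ∈ (a.law s).support, ∀ m, x m ≤ B) (t : ℕ)
    (F : (Fin M → ℕ) × SA × SD → Ω → ℝ) (hF : ∀ e, Measurable[ℱ t] (F e))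
    (hi : ∀ e, Integrable (F e) μ) {S : Set Ω} (hS : MeasurableSet[ℱ t] S) :
    Integrable (fun ω => F (A t ω, sA (t + 1) ω, sD (t + 1) ω) ω) μ ∧
    Integrable (fun ω => ∑ e ∈ box M B ×ˢ (Finset.univ : Finset (SA × SD)),
      (a.law (sA t ω) e.1).toReal * cA.P (sA t ω) e.2.1 * cD.P (sD t ω) e.2.2 * F e ω) μ ∧
    ∫ ω in S, F (A t ω, sA (t + 1) ω, sD (t + 1) ω) ω ∂μ =
      ∫ ω in S, ∑ e ∈ box M B ×ˢ (Finset.univ : Finset (SA × SD)),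
        (a.law (sA t ω) e.1).toReal * cA.P (sA t ω) e.2.1 * cD.P (sD t ω) e.2.2 * F e ω ∂μ := by
  have hsum : (fun ω => F (A t ω, sA (t + 1) ω, sD (t + 1) ω) ω) =ᵐ[μ] fun ω =>
      ∑ e ∈ box M B ×ˢ (Finset.univ : Finset (SA × SD)),
        (jump A sA sD t e).indicator (F e) ω := by
    filter_upwards [h.ae_arrivals_mem_box hB t] with ω hω
    rw [Finset.sum_eq_single (A t ω, sA (t + 1) ω, sD (t + 1) ω)]
    · exact (Set.indicator_of_mem (show ω ∈ jump A sA sD t _ from ⟨rfl, rfl, rfl⟩) _).symm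
    · intro e _ he
      refine Set.indicator_of_notMem (fun hmem => he ?_) _
      obtain ⟨h1, h2, h3⟩ := hmem
      exact Prod.ext h1.symm (Prod.ext h2.symm h3.symm)
    · intro hn
      exact absurd (Finset.mem_product.2 ⟨hω, Finset.mem_univ _⟩) hn
  have hind : ∀ e, Integrable ((jump A sA sD t e).indicator (F e)) μ := fun e =>
    (hi e).indicator (h.measurableSet_jump t e)
  refine ⟨(integrable_finsetSum _ fun e _ => hind e).congr hsum.symm,
    integrable_finsetSum _ fun e _ => (h.setIntegral_jump t e (hF e) (hi e) hS).2, ?_⟩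
  rw [setIntegral_congr_ae (ℱ.le t _ hS) (hsum.mono fun ω hω _ => hω),
    integral_finsetSum _ fun e _ => (hind e).integrableOn,
    integral_finsetSum _ fun e _ => ((h.setIntegral_jump t e (hF e) (hi e) hS).2).integrableOn]
  exact Finset.sum_congr rfl fun e _ => (h.setIntegral_jump t e (hF e) (hi e) hS).1

theorem evolution_flow (h : IsMaxScalarNetwork R C cA cD a G μ ℱ X A D sA sD) (t : ℕ) (ω : Ω) :
    toVec (X (t + 1) ω) = toVec (X t ω) + (toVec (A t ω) - flow R (toVec (D t ω))) := by
  rw [h.evolution, add_sub_assoc]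
  rfl

theorem exists_departures_bound (h : IsMaxScalarNetwork R C cA cD a G μ ℱ X A D sA sD) :
    ∃ B > 0, ∀ t ω, ‖toVec (D t ω)‖ ≤ B := by
  obtain ⟨B, hB0, hB⟩ := C.exists_bound
  exact ⟨B, hB0, fun t ω => hB _ _ (C.feasible_subset _ _ (h.policy t ω).2.1)⟩

theorem exists_step_bound (h : IsMaxScalarNetwork R C cA cD a G μ ℱ X A D sA sD) :
    ∃ B > 0, ∀ t, ∀ᵐ ω ∂μ, ‖toVec (A t ω) - flow R (toVec (D t ω))‖ ≤ B := by
  obtain ⟨Ba, hBa⟩ := a.bounded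
  obtain ⟨Bd, hBd0, hBd⟩ := h.exists_departures_bound
  refine ⟨‖(Ba : ℝ) • ones M‖ + ‖flow R‖ * Bd + 1, by positivity, fun t => ?_⟩
  filter_upwards [h.ae_arrivals_mem_box hBa t] with ω hω
  have h1 : ‖toVec (A t ω)‖ ≤ ‖(Ba : ℝ) • ones M‖ :=
    norm_le_norm_of_abs_le fun m => by simpa [toVec, ones] using mem_box.1 hω m
  have h2 : ‖flow R (toVec (D t ω))‖ ≤ ‖flow R‖ * Bd :=
    ((flow R).le_opNorm _).trans (by gcongr; exact hBd t ω)
  linarith [norm_sub_le (toVec (A t ω)) (flow R (toVec (D t ω)))]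

theorem exists_bound (h : IsMaxScalarNetwork R C cA cD a G μ ℱ X A D sA sD) (t : ℕ) :
    ∃ r, ∀ᵐ ω ∂μ, ‖toVec (X t ω)‖ ≤ r := by
  induction t with
  | zero =>
    obtain ⟨B, hB⟩ := h.initial
    refine ⟨‖(B : ℝ) • ones M‖, hB.mono fun ω hω => norm_le_norm_of_abs_le fun m => ?_⟩
    simpa [toVec, ones] using hω m
  | succ t ih =>
    obtain ⟨r, hr⟩ := ih
    obtain ⟨B, -, hB⟩ := h.exists_step_bound
    refine ⟨r + B, ?_⟩
    filter_upwards [hr, hB t] with ω h1 h2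
    rw [h.evolution_flow]
    exact (norm_add_le _ _).trans (add_le_add h1 h2)

theorem measurable_state (h : IsMaxScalarNetwork R C cA cD a G μ ℱ X A D sA sD)
    (f : (Fin M → ℕ) → (Fin M → ℕ) → SA → SD → ℝ) (t : ℕ) :
    Measurable[ℱ t] fun ω => f (X t ω) (D t ω) (sA t ω) (sD t ω) := by
  have h1 : Measurable fun y : (Fin M → ℕ) × (Fin M → ℕ) × SA × SD =>
      f y.1 y.2.1 y.2.2.1 y.2.2.2 := Measurable.of_discrete
  exact h1.comp ((h.measurable_X t).prodMk ((h.measurable_D t).prodMk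
    ((h.measurable_sA t).prodMk (h.measurable_sD t))))

theorem ae_abs_le (h : IsMaxScalarNetwork R C cA cD a G μ ℱ X A D sA sD)
    (f : (Fin M → ℕ) → (Fin M → ℕ) → SA → SD → ℝ) (t : ℕ) :
    ∃ b, ∀ᵐ ω ∂μ, |f (X t ω) (D t ω) (sA t ω) (sD t ω)| ≤ b := by
  obtain ⟨r, hr⟩ := h.exists_bound t
  obtain ⟨B, -, hB⟩ := h.exists_departures_bound
  obtain ⟨b, hb⟩ := exists_abs_le f (max r B)
  exact ⟨b, hr.mono fun ω hω => hb _ _ _ _ (hω.trans (le_max_left _ _))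
    ((hB t ω).trans (le_max_right _ _))⟩

theorem integrable_state (h : IsMaxScalarNetwork R C cA cD a G μ ℱ X A D sA sD)
    (f : (Fin M → ℕ) → (Fin M → ℕ) → SA → SD → ℝ) (t : ℕ) :
    Integrable (fun ω => f (X t ω) (D t ω) (sA t ω) (sD t ω)) μ := by
  obtain ⟨b, hb⟩ := h.ae_abs_le f t
  exact Integrable.of_bound ((h.measurable_state f t).mono (ℱ.le t) le_rfl).aestronglyMeasurable b
    hb

end IsMaxScalarNetwork

end Network

/-! ### Stability -/

section Stability

variable {M : ℕ} {SA SD : Type*} [Fintype SA] [Fintype SD]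
  [MeasurableSpace SA] [MeasurableSingletonClass SA]
  [MeasurableSpace SD] [MeasurableSingletonClass SD]
  {R : Matrix (Fin M) (Fin M) ℝ} {C : ServiceConstraints M SD} {cA : FiniteChain SA}
  {cD : FiniteChain SD} {a : Arrivals M SA} {G : Vec M → ℝ}
  {Ω : Type*} [mΩ : MeasurableSpace Ω] {μ : Measure Ω} [IsProbabilityMeasure μ]
  {ℱ : Filtration ℕ mΩ} {X A D : ℕ → Ω → Fin M → ℕ} {sA : ℕ → Ω → SA} {sD : ℕ → Ω → SD}

/-- The Lyapunov function: the potential, corrected to average out the modulating chains. -/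
def lyapunov (R : Matrix (Fin M) (Fin M) ℝ) (G : Vec M → ℝ) (f : SA → Vec M) (g : SD → Vec M)
    (x : Fin M → ℕ) (i : SA) (j : SD) : ℝ :=
  |corrected G (toVec x) (f i - flow R (g j))|

theorem IsMaxScalarNetwork.drift (h : IsMaxScalarNetwork R C cA cD a G μ ℱ X A D sA sD)
    (hG : IsWeakPotential R G) {B : ℕ} (hB : ∀ s, ∀ x ∈ (a.law s).support, ∀ m, x m ≤ B)
    {Δ : SD → Vec M} (hΔ : ∀ s, Δ s ∈ C.region s) {δ : ℝ} (hδ : 0 < δ)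
    (hdrift : ∀ᶠ Y in atInfinity M,
      ⟪grad G Y, a.rate cA - flow R (∑ s, cD.stat s • Δ s)⟫_ℝ ≤ -(δ * ‖grad G Y‖))
    {f : SA → Vec M} (hf : ∀ s, f s - ∑ s', cA.P s s' • f s' = a.mean B s - a.rate cA)
    {g : SD → Vec M} (hg : ∀ s, g s - ∑ s', cD.P s s' • g s' = Δ s - ∑ s', cD.stat s' • Δ s')
    (k : ℕ) : ∃ δ' > 0, ∃ K, ∀ t, ∀ S, MeasurableSet[ℱ t] S → (∀ ω ∈ S, K ≤ ‖toVec (X t ω)‖) →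
      ∫ ω in S, lyapunov R G f g (X (t + 1) ω) (sA (t + 1) ω) (sD (t + 1) ω) ^ (k + 1) ∂μ ≤
        ∫ ω in S, lyapunov R G f g (X t ω) (sA t ω) (sD t ω) ^ (k + 1) ∂μ
          - δ' * ∫ ω in S, lyapunov R G f g (X t ω) (sA t ω) (sD t ω) ^ k ∂μ := by
  obtain ⟨B₁, hB₁0, hB₁⟩ := h.exists_step_bound
  obtain ⟨B₂, hB₂⟩ : ∃ B₂, ∀ i j, ‖f i - flow R (g j)‖ ≤ B₂ := by
    obtain ⟨b, hb⟩ := (Set.finite_range fun e : SA × SD => ‖f e.1 - flow R (g e.2)‖).bddAbove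
    exact ⟨b, fun i j => hb ⟨(i, j), rfl⟩⟩
  set b := max B₁ B₂
  have hb0 : 0 < b := hB₁0.trans_le (le_max_left _ _)
  obtain ⟨c, hc0, hc⟩ := hG.grad_nondegenerate
  obtain ⟨K, hK⟩ := eventually_atInfinity.1
    (((hG.corrected_pow_le hb0 (by positivity : 0 < δ / 4) k).and
      (hG.policy_nearly_optimal C (half_pos hδ))).and (hdrift.and hc))
  refine ⟨δ / 4 * c, by positivity, K, fun t S hS hSK => ?_⟩
  -- the step of the corrected process, and the weight of the power
  set Z : (Fin M → ℕ) × SA × SD → Ω → Vec M := fun e ω =>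
    toVec e.1 + f e.2.1 - flow R (g e.2.2) - flow R (toVec (D t ω))
      - (f (sA t ω) - flow R (g (sD t ω))) with hZ
  set L : Ω → ℝ := fun ω => lyapunov R G f g (X t ω) (sA t ω) (sD t ω) with hL
  have hL0 : ∀ ω, 0 ≤ L ω := fun ω => abs_nonneg _
  set γ : Ω → Vec M := fun ω => grad G (toVec (X t ω)) with hγ
  set F : (Fin M → ℕ) × SA × SD → Ω → ℝ := fun e ω => L ω ^ k * ⟪γ ω, Z e ω⟫_ℝ with hF
  have hFm : ∀ e, Measurable[ℱ t] (F e) := fun e => h.measurable_state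
    (fun x d i j => lyapunov R G f g x i j ^ k * ⟪grad G (toVec x),
      toVec e.1 + f e.2.1 - flow R (g e.2.2) - flow R (toVec d) - (f i - flow R (g j))⟫_ℝ) t
  have hFi : ∀ e, Integrable (F e) μ := fun e => h.integrable_state
    (fun x d i j => lyapunov R G f g x i j ^ k * ⟪grad G (toVec x),
      toVec e.1 + f e.2.1 - flow R (g e.2.2) - flow R (toVec d) - (f i - flow R (g j))⟫_ℝ) t
  obtain ⟨hi₁, hi₂, hFeq⟩ := h.setIntegral_transition hB t F hFm hFi hS
  have hLk : ∀ k, Integrable (fun ω => L ω ^ k) μ := fun k =>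
    h.integrable_state (fun x _ i j => lyapunov R G f g x i j ^ k) t
  have hLγ : Integrable (fun ω => L ω ^ k * ‖γ ω‖) μ :=
    h.integrable_state (fun x _ i j => lyapunov R G f g x i j ^ k * ‖grad G (toVec x)‖) t
  have hi₃ : Integrable (fun ω => L ω ^ (k + 1) +
      (k + 1) * F (A t ω, sA (t + 1) ω, sD (t + 1) ω) ω) μ := (hLk _).add (hi₁.const_mul _)
  have hSm : MeasurableSet S := ℱ.le t _ hS
  have hmean : ∀ ω, ∑ e ∈ box M B ×ˢ (Finset.univ : Finset (SA × SD)),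
      (a.law (sA t ω) e.1).toReal * cA.P (sA t ω) e.2.1 * cD.P (sD t ω) e.2.2 * F e ω =
      L ω ^ k * (⟪γ ω, a.rate cA - flow R (∑ s, cD.stat s • Δ s)⟫_ℝ
        + ⟪γ ω, flow R (Δ (sD t ω))⟫_ℝ - ⟪γ ω, flow R (toVec (D t ω))⟫_ℝ) := by
    intro ω
    set p : (Fin M → ℕ) × SA × SD → ℝ := fun e =>
      (a.law (sA t ω) e.1).toReal * cA.P (sA t ω) e.2.1 * cD.P (sD t ω) e.2.2 with hp
    set I := box M B ×ˢ (Finset.univ : Finset (SA × SD))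
    have hp1 : ∑ e ∈ I, p e = 1 := by
      simp only [hp, I, Finset.sum_product, Fintype.sum_prod_type, ← Finset.mul_sum, cA.row_sum,
        cD.row_sum, mul_one, a.sum_law hB]
    have hZsum : ∑ e ∈ I, p e • Z e ω = a.rate cA - flow R (∑ s, cD.stat s • Δ s)
        + flow R (Δ (sD t ω)) - flow R (toVec (D t ω)) := by
      have h1 := a.sum_transition hB cA cD f (fun j => flow R (g j)) (sA t ω) (sD t ω)
      have h2 : ∑ e ∈ I, p e • Z e ω =
          ∑ e ∈ I, p e • (toVec e.1 + f e.2.1 - flow R (g e.2.2)) -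
          (∑ e ∈ I, p e) • (flow R (toVec (D t ω)) + (f (sA t ω) - flow R (g (sD t ω)))) := by
        rw [Finset.sum_smul, ← Finset.sum_sub_distrib]
        refine Finset.sum_congr rfl fun e _ => ?_
        rw [← smul_sub, hZ]
        congr 1
        abel_nf
      rw [h2, hp1, one_smul]
      refine (congrArg (· - _) h1).trans ?_
      have h3 : ∑ j', cD.P (sD t ω) j' • flow R (g j') =
          flow R (∑ j', cD.P (sD t ω) j' • g j') := by simp
      have h4 : ∑ j', cD.P (sD t ω) j' • g j' =
          g (sD t ω) - Δ (sD t ω) + ∑ s', cD.stat s' • Δ s' :=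
        (sub_sub_self (g (sD t ω)) _).symm.trans (by rw [hg]; abel)
      have h5 : a.mean B (sA t ω) = f (sA t ω) - ∑ s', cA.P (sA t ω) s' • f s' + a.rate cA := by
        rw [hf]; abel
      rw [h3, h4, h5, map_add, map_sub]
      abel_nf
    calc ∑ e ∈ I, p e * F e ω = L ω ^ k * ⟪γ ω, ∑ e ∈ I, p e • Z e ω⟫_ℝ := by
          rw [inner_sum, Finset.mul_sum]
          refine Finset.sum_congr rfl fun e _ => ?_
          rw [inner_smul_right, hF]
          ring
      _ = _ := by rw [hZsum, inner_sub_right, inner_add_right]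
  calc ∫ ω in S, lyapunov R G f g (X (t + 1) ω) (sA (t + 1) ω) (sD (t + 1) ω) ^ (k + 1) ∂μ
      ≤ ∫ ω in S, (L ω ^ (k + 1) + (k + 1) * F (A t ω, sA (t + 1) ω, sD (t + 1) ω) ω
          + δ / 4 * (L ω ^ k * ‖γ ω‖)) ∂μ := by
        refine setIntegral_mono_on_ae
          (h.integrable_state (fun x _ i j => lyapunov R G f g x i j ^ (k + 1))
            (t + 1)).integrableOn
          (hi₃.add (hLγ.const_mul _)).integrableOn hSm ?_
        filter_upwards [hB₁ t] with ω hω hωS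
        have hcp := (hK _ (toVec_mem_orthant _) (hSK ω hωS)).1.1
          (toVec (A t ω) - flow R (toVec (D t ω))) (f (sA t ω) - flow R (g (sD t ω)))
          (f (sA (t + 1) ω) - flow R (g (sD (t + 1) ω))) (hω.trans (le_max_left _ _))
          ((hB₂ _ _).trans (le_max_right _ _)) ((hB₂ _ _).trans (le_max_right _ _))
          (by rw [← h.evolution_flow]; exact toVec_mem_orthant _)
        rw [← h.evolution_flow] at hcp
        refine hcp.trans (le_of_eq ?_)
        have hZeq : Z (A t ω, sA (t + 1) ω, sD (t + 1) ω) ω =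
            toVec (A t ω) - flow R (toVec (D t ω)) + (f (sA (t + 1) ω)
              - flow R (g (sD (t + 1) ω))) - (f (sA t ω) - flow R (g (sD t ω))) := by
          simp only [hZ]
          abel
        simp only [hF, hZeq, hL, hγ, lyapunov]
        ring
    _ = ∫ ω in S, L ω ^ (k + 1) ∂μ
          + (k + 1) * (∫ ω in S, F (A t ω, sA (t + 1) ω, sD (t + 1) ω) ω ∂μ)
          + δ / 4 * ∫ ω in S, L ω ^ k * ‖γ ω‖ ∂μ := by
        rw [integral_add hi₃.integrableOn (hLγ.const_mul _).integrableOn, integral_add (hLk _).integrableOn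
          (hi₁.const_mul _).integrableOn, integral_const_mul, integral_const_mul]
    _ ≤ ∫ ω in S, L ω ^ (k + 1) ∂μ + (k + 1) * (-(δ / 2) * ∫ ω in S, L ω ^ k * ‖γ ω‖ ∂μ)
          + δ / 4 * ∫ ω in S, L ω ^ k * ‖γ ω‖ ∂μ := by
        gcongr
        rw [hFeq, ← integral_const_mul]
        refine setIntegral_mono_on hi₂.integrableOn (hLγ.const_mul _).integrableOn hSm
          fun ω hωS => ?_
        obtain ⟨⟨-, hpol⟩, hdr, -⟩ := hK _ (toVec_mem_orthant _) (hSK ω hωS)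
        have h1 := hpol (X t ω) (D t ω) rfl (sD t ω) (h.policy t ω) _ (hΔ (sD t ω))
        rw [hmean]
        calc _ ≤ L ω ^ k * (-(δ / 2) * ‖γ ω‖) := by
              refine mul_le_mul_of_nonneg_left ?_ (pow_nonneg (hL0 ω) k)
              simp only [hγ]
              linarith
          _ = _ := by ring
    _ ≤ ∫ ω in S, L ω ^ (k + 1) ∂μ - δ / 4 * (∫ ω in S, L ω ^ k * ‖γ ω‖ ∂μ) := by
        have h0 : 0 ≤ ∫ ω in S, L ω ^ k * ‖γ ω‖ ∂μ :=
          integral_nonneg fun ω => mul_nonneg (pow_nonneg (hL0 ω) k) (norm_nonneg _)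
        have hk : (0 : ℝ) ≤ k := Nat.cast_nonneg k
        nlinarith [mul_nonneg hk (mul_nonneg hδ.le h0)]
    _ ≤ ∫ ω in S, L ω ^ (k + 1) ∂μ - δ / 4 * c * ∫ ω in S, L ω ^ k ∂μ := by
        rw [mul_assoc]
        gcongr
        rw [← integral_const_mul]
        refine setIntegral_mono_on ((hLk _).const_mul _).integrableOn hLγ.integrableOn hSm
          fun ω hωS => ?_
        rw [mul_comm]
        exact mul_le_mul_of_nonneg_left (hK _ (toVec_mem_orthant _) (hSK ω hωS)).2.2
          (pow_nonneg (hL0 ω) k)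

/-- A network run by the max-scalar policy of a weak potential has bounded moments. -/
theorem IsMaxScalarNetwork.isStable (h : IsMaxScalarNetwork R C cA cD a G μ ℱ X A D sA sD)
    (hR : IsRouting R) (hadm : IsAdmissible R C cD (a.rate cA)) (hG : IsWeakPotential R G)
    (n : ℕ) : IsStable μ X fun x => ‖x‖ ^ n := by
  obtain ⟨B, hB⟩ := a.bounded
  obtain ⟨Δ, hΔ, δ, hδ, hdrift⟩ := hG.exists_departures hR hadm
  obtain ⟨f, hf⟩ := cA.exists_poisson_vec (a.mean B)
  obtain ⟨g, hg⟩ := cD.exists_poisson_vec Δ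
  rw [a.sum_stat_mean hB] at hf
  choose δ' hδ' K hK using h.drift hG hB hΔ hδ hdrift hf hg
  obtain ⟨δ₀, hδ₀, hδ₀le⟩ : ∃ δ₀ > 0, ∀ k ≤ n + 2, δ₀ ≤ δ' k := by
    refine ⟨(Finset.range (n + 3)).inf' (by simp) δ', ?_, fun k hk => ?_⟩
    · exact (Finset.lt_inf'_iff _).2 fun k _ => hδ' k
    · exact Finset.inf'_le _ (by simpa [Nat.lt_succ_iff] using hk)
  obtain ⟨K₀, hK₀⟩ : ∃ K₀, ∀ k ≤ n + 2, K k ≤ K₀ :=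
    ⟨(Finset.range (n + 3)).sup' (by simp) K, fun k hk =>
      Finset.le_sup' _ (by simpa [Nat.lt_succ_iff] using hk)⟩
  obtain ⟨r₀, hr₀⟩ := h.exists_bound 0
  obtain ⟨B₁, hB₁0, hB₁⟩ := h.exists_step_bound
  obtain ⟨b, hb⟩ := exists_abs_le (fun x (_ : Fin M → ℕ) (i : SA) (j : SD) =>
    lyapunov R G f g x i j) (max K₀ r₀ + B₁)
  have hle : ∀ x i j, ‖toVec x‖ ≤ max K₀ r₀ + B₁ → lyapunov R G f g x i j ≤ b :=
    fun x i j hx => (le_abs_self _).trans (hb x x i j hx hx)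
  set V : ℕ → Ω → ℝ := fun t ω => lyapunov R G f g (X t ω) (sA t ω) (sD t ω) with hV
  have hV0 : ∀ t ω, 0 ≤ V t ω := fun t ω => abs_nonneg _
  set κ : ℕ → Set Ω := fun t => {ω | t = 0 ∨ ‖toVec (X t ω)‖ < K₀} with hκ
  have hκm : ∀ t, MeasurableSet[ℱ t] (κ t) := by
    intro t
    have hm : Measurable[ℱ t] fun ω => (‖toVec (X t ω)‖ : ℝ) :=
      h.measurable_state (fun x _ _ _ => ‖toVec x‖) t
    exact (MeasurableSet.const _).union (hm measurableSet_Iio)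
  have hVb : ∀ t, ∃ b, ∀ᵐ ω ∂μ, V t ω ≤ b := by
    intro t
    obtain ⟨b', hb'⟩ := h.ae_abs_le (fun x _ i j => lyapunov R G f g x i j) t
    exact ⟨b', hb'.mono fun ω hω => (le_abs_self _).trans hω⟩
  have hVκ : ∀ t, ∀ᵐ ω ∂μ, ω ∈ κ t → V t ω ≤ b ∧ V (t + 1) ω ≤ b := by
    intro t
    filter_upwards [hr₀, hB₁ t] with ω h1 h2 hω
    have h3 : ‖toVec (X t ω)‖ ≤ max K₀ r₀ := by
      rcases hω with rfl | hω
      · exact h1.trans (le_max_right _ _)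
      · exact hω.le.trans (le_max_left _ _)
    refine ⟨hle _ _ _ (h3.trans (le_add_of_nonneg_right hB₁0.le)), hle _ _ _ ?_⟩
    rw [h.evolution_flow]
    exact (norm_add_le _ _).trans (add_le_add h3 h2)
  have hVd : ∀ t, ∀ S, MeasurableSet[ℱ t] S → S ⊆ (κ t)ᶜ → ∀ k ≤ n + 2,
      ∫ ω in S, V (t + 1) ω ^ (k + 1) ∂μ
        ≤ ∫ ω in S, V t ω ^ (k + 1) ∂μ - δ₀ * ∫ ω in S, V t ω ^ k ∂μ := by
    intro t S hS hSκ k hk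
    refine (hK k t S hS fun ω hω => ?_).trans ?_
    · exact (hK₀ k hk).trans (not_lt.1 fun hlt => hSκ hω (Or.inr hlt))
    · refine sub_le_sub_left (mul_le_mul_of_nonneg_right (hδ₀le k hk) ?_) _
      exact integral_nonneg fun ω => pow_nonneg (hV0 t ω) k
  have hVm : ∀ t, Measurable (V t) := fun t =>
    (h.measurable_state (fun x _ i j => lyapunov R G f g x i j) t).mono (ℱ.le t) le_rfl
  obtain ⟨c, hc⟩ := exists_moment_bound μ ℱ V κ (by simp [hκ]) hκm hVm hV0 hVb hδ₀ hVκ n hVd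
  -- from the Lyapunov function back to the norm
  obtain ⟨B₂, hB₂⟩ : ∃ B₂, ∀ i j, ‖f i - flow R (g j)‖ ≤ B₂ := by
    obtain ⟨b, hb⟩ := (Set.finite_range fun e : SA × SD => ‖f e.1 - flow R (g e.2)‖).bddAbove
    exact ⟨b, fun i j => hb ⟨(i, j), rfl⟩⟩
  obtain ⟨r, hr⟩ := eventually_atInfinity.1
    (hG.norm_le_corrected (lt_max_of_lt_right one_pos : 0 < max B₂ 1))
  set r₁ := max r 1
  have hr1 : 1 ≤ r₁ := le_max_right _ _
  have hbound : ∀ t ω, ‖toVec (X t ω)‖ ^ n ≤ r₁ ^ n + V t ω ^ (n + 1) := by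
    intro t ω
    rcases le_total ‖toVec (X t ω)‖ r₁ with hx | hx
    · calc _ ≤ r₁ ^ n := pow_le_pow_left₀ (norm_nonneg _) hx n
        _ ≤ _ := le_add_of_nonneg_right (pow_nonneg (hV0 t ω) _)
    · have h1 : ‖toVec (X t ω)‖ ≤ V t ω :=
        (hr _ (toVec_mem_orthant _) ((le_max_left _ _).trans hx) _
          ((hB₂ _ _).trans (le_max_left _ _))).1.trans (le_abs_self _)
      calc ‖toVec (X t ω)‖ ^ n ≤ ‖toVec (X t ω)‖ ^ (n + 1) :=
            pow_le_pow_right₀ (hr1.trans hx) (Nat.le_succ n)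
        _ ≤ V t ω ^ (n + 1) := pow_le_pow_left₀ (norm_nonneg _) h1 _
        _ ≤ _ := le_add_of_nonneg_left (by positivity)
  refine lt_of_le_of_lt (limsup_le_of_le (a := ENNReal.ofReal (r₁ ^ n + c)) (by isBoundedDefault)
    (Eventually.of_forall fun t => ?_)) ENNReal.ofReal_lt_top
  have hint : Integrable (fun ω => r₁ ^ n + V t ω ^ (n + 1)) μ :=
    h.integrable_state (fun x _ i j => r₁ ^ n + lyapunov R G f g x i j ^ (n + 1)) t
  have hintV : Integrable (fun ω => V t ω ^ (n + 1)) μ :=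
    h.integrable_state (fun x _ i j => lyapunov R G f g x i j ^ (n + 1)) t
  calc ∫⁻ ω, ENNReal.ofReal (‖toVec (X t ω)‖ ^ n) ∂μ
      ≤ ∫⁻ ω, ENNReal.ofReal (r₁ ^ n + V t ω ^ (n + 1)) ∂μ :=
        lintegral_mono fun ω => ENNReal.ofReal_le_ofReal (hbound t ω)
    _ = ENNReal.ofReal (∫ ω, (r₁ ^ n + V t ω ^ (n + 1)) ∂μ) :=
        (ofReal_integral_eq_lintegral_ofReal hint (ae_of_all _ fun ω =>
          add_nonneg (by positivity) (pow_nonneg (hV0 t ω) _))).symm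
    _ ≤ ENNReal.ofReal (r₁ ^ n + c) := by
        refine ENNReal.ofReal_le_ofReal ?_
        rw [integral_add (integrable_const _) hintV]
        simpa using hc t

end Stability

end QueueNet

end

theorem mainTheorem3 {M : ℕ} {SA SD : Type*} [Fintype SA] [Fintype SD]
    [MeasurableSpace SA] [MeasurableSingletonClass SA]
    [MeasurableSpace SD] [MeasurableSingletonClass SD]
    (R : Matrix (Fin M) (Fin M) ℝ) (hR : QueueNet.IsRouting R)
    (C : QueueNet.ServiceConstraints M SD) (cA : QueueNet.FiniteChain SA)
    (cD : QueueNet.FiniteChain SD) (a : QueueNet.Arrivals M SA)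
    (hadm : QueueNet.IsAdmissible R C cD (a.rate cA))
    (G : QueueNet.Vec M → ℝ)
    {Ω : Type*} [mΩ : MeasurableSpace Ω] (μ : Measure Ω) [IsProbabilityMeasure μ]
    (ℱ : Filtration ℕ mΩ) (X A D : ℕ → Ω → Fin M → ℕ) (sA : ℕ → Ω → SA) (sD : ℕ → Ω → SD)
    (hnet : QueueNet.IsMaxScalarNetwork R C cA cD a G μ ℱ X A D sA sD) :
    (QueueNet.IsWeakPotential R G → a.IsIID → C.IsStatic →
      ∀ h : ℕ, QueueNet.IsStable μ X (fun x => ‖x‖ ^ h)) ∧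
    (QueueNet.IsStrongPotential R G →
      ∀ h : ℕ, QueueNet.IsStable μ X (fun x => ‖x‖ ^ h)) := by
  exact ⟨fun hG _ _ => hnet.isStable hR hadm hG,
    fun hG => hnet.isStable hR hadm hG.isWeakPotential⟩
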